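/- Let $M$ be a smooth manifold, $A=\mathcal O_M=C^\infty(M,\mathbb R)$ and $T_A=\mathrm{Der}_{\mathbb R}(A)$ (in degree $0$). An $L_\infty$-algebroid over $A$ is a non-negatively graded $A$-module $L=\bigoplus_{n\ge 0}L_n$ with $\mathbb R$-multilinear graded antisymmetric brackets $[\ ]_k\colon L^{k}\to L$ ($k\ge 1$) of degree $k-2$ satisfying the higher Jacobi identities $$\sum_{i+j=k}(-1)^{ij}\sum_{\sigma}\chi(\sigma,v)\big[[v_{\sigma(1)},\dots,v_{\sigma(i)}]_i,v_{\sigma(i+1)},\dots,v_{\sigma(k)}\big]_{j+1}=0$$ (the inner sum is over $(i,j)$-unshuffles, and $v_1\wedge\dots\wedge v_k=\chi(\sigma,v)\,v_{\sigma(1)}\wedge\dots\wedge v_{\sigma(k)}$), together with an $A$-linear map $\rho\colon L\to T_A$ of degree $0$ with $\rho[v]_1=0$ and $\rho[v,w]_2=[\rho v,\rho w]$, such that $[v,aw]_2=a[v,w]_2+\rho(v)(a)w$ and all other brackets are $A$-linear in the last argument. The category $L_\infty/\mathcal O_M$ has as morphisms the degree-preserving $A$-linear maps that preserve all brackets and the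 anchors $\rho$. A morphism is a weak equivalence if it is a quasi-isomorphism for the differentials $[\ ]_1$, a fibration if it is surjective in all positive degrees, and a cofibration if it has the left lifting property against all morphisms that are both fibrations and weak equivalences. An object $L$ is cofibrant if the map $0\to L$ from the initial object is a cofibration. Two morphisms $f,g\colon L\to X$ are left homotopic, $f\overset{l}{\sim}g$, if there are an object $C$, morphisms $i_0,i_1\colon L\to C$, a weak equivalence $p\colon C\to L$ with $p i_0=p i_1=\mathrm{id}_L$, and a morphism $H\colon C\to X$ with $Hi_0=f$ and $Hi_1=g$. **Theorem.** In $L_\infty/\mathcal O_M$, let $L$ be cofibrant. Then: 1. For every object $X$, left homotopy $\overset{l}{\sim}$ is an equivalence relation on $\mathrm{Hom}(L,X)$. 2. Left homotopy is compatible with composition: if $f\overset{l}{\sim}f'\colon L\to X$ and $g\overset{l}{\sim}g'\colon X\to Y$, then $gf\overset{l}{\sim}g'f'$; and if $h\colon K\to L$ is any morphism and $f\overset{l}{\sim}f'\colon L\to X$, then $fh\overset{l}{\sim}f'h$. -/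

import Mathlib

open CategoryTheory CategoryTheory.Limits HomotopicalAlgebra
open scoped Manifold ContDiff

universe w u v

/-- The sign `χ(σ, v)` with `v₁ ∧ ⋯ ∧ vₙ = χ(σ, v) v_{σ(1)} ∧ ⋯ ∧ v_{σ(n)}` in the graded exterior
power, for homogeneous `vᵢ` of degree `d i`: each inversion of `σ` exchanges two elements of degrees
`p`, `q` and contributes the factor `-(-1)^{pq}`. -/
def koszulSign {n : ℕ} (σ : Equiv.Perm (Fin n)) (d : Fin n → ℕ) : ℤ :=
  ∏ a : Fin n, ∏ b : Fin n,
    if a < b ∧ σ b < σ a then -(-1 : ℤ) ^ (d (σ a) * d (σ b)) else 1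

/-- `σ` is an `(i, n - i)`-unshuffle: it is increasing on the first `i` and on the last `n - i`
positions. -/
def IsUnshuffle {n : ℕ} (i : ℕ) (σ : Equiv.Perm (Fin n)) : Prop :=
  (∀ a b : Fin n, a < b → (b : ℕ) < i → σ a < σ b) ∧
    (∀ a b : Fin n, a < b → i ≤ (a : ℕ) → σ a < σ b)

instance {n : ℕ} (i : ℕ) : DecidablePred (IsUnshuffle (n := n) i) := fun σ => by
  unfold IsUnshuffle
  infer_instance

/-- A non-negatively graded `L_∞`-algebroid over the commutative `k`-algebra `A` (which sits in
degree `0`): a non-negatively (homologically) graded `A`-module `L = ⨁ₙ Lₙ` with `k`-multilinear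
graded antisymmetric brackets `[ ]ₙ` of degree `n - 2` satisfying the higher Jacobi identities, and an
`A`-linear anchor of degree `0` from `L` to the derivations of `A`, compatible with the brackets.
The differential is `[ ]₁`. -/
structure LInfAlgebroid (k : Type w) (A : Type u) [Field k] [CommRing A] [Algebra k A] where
  /-- the total module `⨁ₙ Lₙ` -/
  carrier : Type v
  [addCommGroup : AddCommGroup carrier]
  [moduleBase : Module k carrier]
  [module : Module A carrier]
  [isScalarTower : IsScalarTower k A carrier]
  /-- the homogeneous component of degree `n` -/
  deg : ℕ → Submodule A carrier
  isInternal : DirectSum.IsInternal deg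
  /-- the bracket `[ ]ₙ`. (The one of arity `0` has degree `-2`, so it vanishes by
  `br_eq_zero`; the structure consists of the brackets of arity at least `1`.) -/
  br : (n : ℕ) → MultilinearMap k (fun _ : Fin n => carrier) carrier
  /-- the anchor -/
  anchor : carrier →ₗ[A] Derivation k A A
  /-- `[ ]ₙ` has degree `n - 2`. -/
  br_mem : ∀ (n : ℕ) (d : Fin n → ℕ) (x : Fin n → carrier), (∀ i, x i ∈ deg (d i)) →
    ∀ m : ℕ, (∑ i, d i) + n = m + 2 → br n x ∈ deg m
  /-- There is nothing in negative degrees. -/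
  br_eq_zero : ∀ (n : ℕ) (d : Fin n → ℕ) (x : Fin n → carrier), (∀ i, x i ∈ deg (d i)) →
    (∑ i, d i) + n < 2 → br n x = 0
  /-- graded antisymmetry, for the exchange of two neighbours -/
  br_swap : ∀ (n : ℕ) (d : Fin n → ℕ) (x : Fin n → carrier), (∀ i, x i ∈ deg (d i)) →
    ∀ i j : Fin n, (i : ℕ) + 1 = j →
      br n (x ∘ Equiv.swap i j) = (-(-1 : ℤ) ^ (d i * d j)) • br n x
  /-- the higher Jacobi identities -/
  jacobi : ∀ (n : ℕ) (d : Fin n → ℕ) (x : Fin n → carrier), (∀ i, x i ∈ deg (d i)) →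
    ∑ i : Fin (n + 1), (-1 : ℤ) ^ ((i : ℕ) * (n - (i : ℕ))) •
      ∑ σ : Equiv.Perm (Fin n) with IsUnshuffle i σ,
        koszulSign σ d •
          br (n - (i : ℕ) + 1)
            (Fin.cons (br i fun a : Fin (i : ℕ) => x (σ ⟨a, by omega⟩))
              fun b : Fin (n - (i : ℕ)) => x (σ ⟨(i : ℕ) + b, by omega⟩)) = 0
  /-- All brackets but the binary one are `A`-linear in the last argument. -/
  br_smul : ∀ (n : ℕ), n + 1 ≠ 2 → ∀ (x : Fin (n + 1) → carrier) (a : A),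
    br (n + 1) (Function.update x (Fin.last n) (a • x (Fin.last n))) = a • br (n + 1) x
  /-- the Leibniz rule for the binary bracket -/
  br_leibniz : ∀ (x y : carrier) (a : A),
    br 2 ![x, a • y] = a • br 2 ![x, y] + anchor x a • y
  /-- The anchor has degree `0`, the derivations of `A` being in degree `0`. -/
  anchor_of_pos : ∀ (n : ℕ), 0 < n → ∀ x ∈ deg n, anchor x = 0
  /-- The anchor is a chain map. -/
  anchor_br_one : ∀ x : carrier, anchor (br 1 ![x]) = 0
  /-- The anchor takes the binary bracket to the commutator of derivations. (The higher
  brackets have positive degree, hence anchor zero.) -/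
  anchor_br_two : ∀ x y : carrier, anchor (br 2 ![x, y]) = ⁅anchor x, anchor y⁆

namespace LInfAlgebroid

variable {k : Type w} {A : Type u} [Field k] [CommRing A] [Algebra k A]

instance : CoeSort (LInfAlgebroid.{w, u, v} k A) (Type v) := ⟨carrier⟩

attribute [instance] addCommGroup moduleBase module isScalarTower

/-- A (strict) morphism of `L_∞`-algebroids over `A`: an `A`-linear map of degree `0` that
preserves all brackets and the anchors. -/
@[ext]
structure Hom (L L' : LInfAlgebroid.{w, u, v} k A) where
  toLin : L →ₗ[A] L'
  map_deg : ∀ (n : ℕ), ∀ x ∈ L.deg n, toLin x ∈ L'.deg n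
  map_br : ∀ (n : ℕ) (x : Fin n → L), toLin (L.br n x) = L'.br n (fun i => toLin (x i))
  map_anchor : ∀ x : L, L'.anchor (toLin x) = L.anchor x

/-- The category `L_∞/A`. -/
instance : Category (LInfAlgebroid.{w, u, v} k A) where
  Hom := Hom
  id L := ⟨LinearMap.id, fun _ _ h => h, fun _ _ => rfl, fun _ => rfl⟩
  comp f g := ⟨g.toLin ∘ₗ f.toLin, fun n x h => g.map_deg n _ (f.map_deg n x h),
    fun n x => by simp [f.map_br, g.map_br], fun x => by simp [f.map_anchor, g.map_anchor]⟩

/-- The differential `[ ]₁`. -/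
def diff (L : LInfAlgebroid.{w, u, v} k A) : L →ₗ[A] L where
  toFun x := L.br 1 ![x]
  map_add' x y := by
    have h := (L.br 1).map_update_add ![x] 0 x y
    have e : ∀ z : L, Function.update ![x] 0 z = ![z] := fun z => by
      ext i; fin_cases i; simp
    simpa [e] using h
  map_smul' a x := by
    have h := L.br_smul 0 (by norm_num) ![x] a
    have e : Function.update ![x] (Fin.last 0) (a • (![x] : Fin 1 → L) (Fin.last 0)) = ![a • x] := by
      ext i; fin_cases i; simp
    rw [e] at h
    exact h

/-- the cycles of degree `n` -/
def cycles (L : LInfAlgebroid.{w, u, v} k A) (n : ℕ) : Submodule A L :=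
  L.deg n ⊓ LinearMap.ker L.diff

/-- the boundaries of degree `n` -/
def boundaries (L : LInfAlgebroid.{w, u, v} k A) (n : ℕ) : Submodule A L :=
  (L.deg (n + 1)).map L.diff

/-- the homology in degree `n` -/
abbrev homology (L : LInfAlgebroid.{w, u, v} k A) (n : ℕ) : Type v :=
  L.cycles n ⧸ (L.boundaries n).submoduleOf (L.cycles n)

lemma Hom.map_diff {L L' : LInfAlgebroid.{w, u, v} k A} (f : Hom L L') (x : L) :
    f.toLin (L.diff x) = L'.diff (f.toLin x) := by
  have h := f.map_br 1 ![x]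
  have e : (fun i => f.toLin ((![x] : Fin 1 → L) i)) = ![f.toLin x] := by
    ext i; fin_cases i; simp
  rw [e] at h
  exact h

/-- the map induced on cycles -/
def Hom.cyclesMap {L L' : LInfAlgebroid.{w, u, v} k A} (f : Hom L L') (n : ℕ) :
    L.cycles n →ₗ[A] L'.cycles n :=
  f.toLin.restrict fun x hx => ⟨f.map_deg n x hx.1, LinearMap.mem_ker.2 (by
    rw [← f.map_diff, LinearMap.mem_ker.1 hx.2, map_zero])⟩

/-- the map induced on homology -/
def Hom.homologyMap {L L' : LInfAlgebroid.{w, u, v} k A} (f : Hom L L') (n : ℕ) :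
    L.homology n →ₗ[A] L'.homology n :=
  Submodule.mapQ _ _ (f.cyclesMap n) (by
    rintro ⟨x, hx⟩ ⟨y, hy, rfl⟩
    exact ⟨f.toLin y, f.map_deg _ y hy, (f.map_diff y).symm⟩)

/-- The weak equivalences are the quasi-isomorphisms. -/
instance : CategoryWithWeakEquivalences (LInfAlgebroid.{w, u, v} k A) where
  weakEquivalences := fun _ _ f => ∀ n : ℕ, Function.Bijective (Hom.homologyMap f n)

/-- The fibrations are the morphisms that are surjective in all positive degrees. -/
instance : CategoryWithFibrations (LInfAlgebroid.{w, u, v} k A) where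
  fibrations := fun L L' f => ∀ n : ℕ, 0 < n → ∀ y ∈ L'.deg n, ∃ x ∈ L.deg n, Hom.toLin f x = y

/-- The cofibrations are the morphisms with the left lifting property against the trivial
fibrations. -/
instance : CategoryWithCofibrations (LInfAlgebroid.{w, u, v} k A) where
  cofibrations := (trivialFibrations (LInfAlgebroid.{w, u, v} k A)).llp

/-- the zero algebroid -/
def zero : LInfAlgebroid.{w, u, v} k A where
  carrier := PUnit.{v + 1}
  deg _ := ⊥
  isInternal := by
    refine ⟨fun x y _ => DFinsupp.ext fun i => Subsingleton.elim _ _, fun y => ?_⟩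
    exact ⟨DFinsupp.mk ∅ fun i => ⟨0, Submodule.zero_mem _⟩, Subsingleton.elim _ _⟩
  br _ := 0
  anchor := 0
  br_mem _ _ _ _ _ _ := Submodule.zero_mem _
  br_eq_zero _ _ _ _ _ := rfl
  br_swap _ _ _ _ _ _ _ := Subsingleton.elim _ _
  jacobi _ _ _ _ := Subsingleton.elim _ _
  br_smul _ _ _ _ := Subsingleton.elim _ _
  br_leibniz _ _ _ := Subsingleton.elim _ _
  anchor_of_pos _ _ _ _ := rfl
  anchor_br_one _ := rfl
  anchor_br_two _ _ := (lie_zero (0 : Derivation k A A)).symm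

lemma br_zero (L : LInfAlgebroid.{w, u, v} k A) (n : ℕ) : L.br n (fun _ => (0 : L)) = 0 := by
  cases n with
  | zero => exact L.br_eq_zero 0 0 _ (fun i => i.elim0) (by simp)
  | succ n => exact (L.br (n + 1)).map_coord_zero 0 rfl

/-- The zero algebroid is an initial object. -/
def zeroIsInitial : IsInitial (zero : LInfAlgebroid.{w, u, v} k A) :=
  IsInitial.ofUniqueHom
    (fun L => (⟨0, fun _ _ _ => Submodule.zero_mem _, fun n _ => (L.br_zero n).symm,
      fun _ => map_zero L.anchor⟩ : Hom zero L))
    (fun L m => by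
      apply Hom.ext
      ext x
      have hx : x = 0 := Subsingleton.elim (α := PUnit) x 0
      rw [hx, map_zero, map_zero])

instance : HasInitial (LInfAlgebroid.{w, u, v} k A) := zeroIsInitial.hasInitial

end LInfAlgebroid

namespace KoszulSign

variable {n : ℕ}

/-- The pairs of positions `a < b`. -/
def pairs (n : ℕ) : Finset (Fin n × Fin n) := Finset.univ.filter fun p => p.1 < p.2

lemma mem_pairs {p : Fin n × Fin n} : p ∈ pairs n ↔ p.1 < p.2 := by simp [pairs]

lemma prod_prod_ite (f : Fin n → Fin n → ℤ) (P : Fin n → Fin n → Prop)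
    [∀ a b, Decidable (P a b)] :
    ∏ a : Fin n, ∏ b : Fin n, (if a < b ∧ P a b then f a b else 1)
      = ∏ p ∈ pairs n, if P p.1 p.2 then f p.1 p.2 else 1 := by
  rw [pairs, Finset.prod_filter, ← Finset.univ_product_univ, Finset.prod_product]
  refine Finset.prod_congr rfl fun a _ => Finset.prod_congr rfl fun b _ => ?_
  by_cases h : a < b <;> simp [h]

lemma koszulSign_eq (σ : Equiv.Perm (Fin n)) (d : Fin n → ℕ) :
    koszulSign σ d = ∏ p ∈ pairs n,
      if σ p.2 < σ p.1 then -(-1 : ℤ) ^ (d (σ p.1) * d (σ p.2)) else 1 :=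
  prod_prod_ite (fun a b => -(-1 : ℤ) ^ (d (σ a) * d (σ b))) (fun a b => σ b < σ a)

/-- A product over unordered pairs can be reindexed by a permutation. -/
lemma prod_pairs_perm (τ : Equiv.Perm (Fin n)) (F : Fin n → Fin n → ℤ)
    (hF : ∀ a b, F a b = F b a) :
    ∏ p ∈ pairs n, F (τ p.1) (τ p.2) = ∏ p ∈ pairs n, F p.1 p.2 := by
  have key : ∀ (τ : Equiv.Perm (Fin n)) (p : Fin n × Fin n), p ∈ pairs n →
      (if τ p.1 < τ p.2 then (τ p.1, τ p.2) else (τ p.2, τ p.1)) ∈ pairs n := by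
    intro τ p hp
    rw [mem_pairs] at hp ⊢
    split_ifs with h
    · exact h
    · exact lt_of_le_of_ne (not_lt.1 h) fun e => hp.ne' (τ.injective e)
  have inv : ∀ (τ τ' : Equiv.Perm (Fin n)) (_ : ∀ a, τ' (τ a) = a) (p : Fin n × Fin n),
      p ∈ pairs n →
      (fun q : Fin n × Fin n => if τ' q.1 < τ' q.2 then (τ' q.1, τ' q.2) else (τ' q.2, τ' q.1))
        (if τ p.1 < τ p.2 then (τ p.1, τ p.2) else (τ p.2, τ p.1)) = p := by
    intro τ τ' h p hp
    rw [mem_pairs] at hp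
    split_ifs with h1
    · simp [h, hp]
    · simp [h, hp.not_gt]
  refine Finset.prod_nbij'
    (fun p => if τ p.1 < τ p.2 then (τ p.1, τ p.2) else (τ p.2, τ p.1))
    (fun p => if τ⁻¹ p.1 < τ⁻¹ p.2 then (τ⁻¹ p.1, τ⁻¹ p.2) else (τ⁻¹ p.2, τ⁻¹ p.1))
    (key τ) (key τ⁻¹) (inv τ τ⁻¹ (by simp)) (inv τ⁻¹ τ (by simp)) ?_
  intro p _
  split_ifs
  · rfl
  · exact hF _ _

lemma neg_one_pow_mul_self (m : ℕ) : (-1 : ℤ) ^ m * (-1) ^ m = 1 := by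
  rw [← mul_pow]; simp

@[simp]
lemma koszulSign_one (d : Fin n → ℕ) : koszulSign 1 d = 1 := by
  rw [koszulSign_eq]
  refine Finset.prod_eq_one fun p hp => ?_
  rw [mem_pairs] at hp
  simp [hp.not_gt]

lemma koszulSign_mul (σ τ : Equiv.Perm (Fin n)) (d : Fin n → ℕ) :
    koszulSign (σ * τ) d = koszulSign σ d * koszulSign τ (d ∘ σ) := by
  have h := prod_pairs_perm τ
    (fun a b => if (a < b ↔ σ a < σ b) then 1 else -(-1 : ℤ) ^ (d (σ a) * d (σ b))) (by
      intro a b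
      rcases lt_trichotomy a b with hab | rfl | hab
      · have : σ a ≠ σ b := fun e => hab.ne (σ.injective e)
        rcases this.lt_or_gt with h | h <;> simp [hab, hab.not_gt, h, h.not_gt, mul_comm]
      · rfl
      · have : σ a ≠ σ b := fun e => hab.ne' (σ.injective e)
        rcases this.lt_or_gt with h | h <;> simp [hab, hab.not_gt, h, h.not_gt, mul_comm])
  have h' : koszulSign σ d = ∏ p ∈ pairs n,
      if (p.1 < p.2 ↔ σ p.1 < σ p.2) then 1 else -(-1 : ℤ) ^ (d (σ p.1) * d (σ p.2)) := by
    rw [koszulSign_eq]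
    refine Finset.prod_congr rfl fun p hp => ?_
    rw [mem_pairs] at hp
    have : σ p.1 ≠ σ p.2 := fun e => hp.ne (σ.injective e)
    rcases this.lt_or_gt with h | h <;> simp [hp, h, h.not_gt]
  rw [h', ← h, koszulSign_eq, koszulSign_eq, ← Finset.prod_mul_distrib]
  refine Finset.prod_congr rfl fun p hp => ?_
  rw [mem_pairs] at hp
  have h1 : τ p.1 ≠ τ p.2 := fun e => hp.ne (τ.injective e)
  have h2 : σ (τ p.1) ≠ σ (τ p.2) := fun e => h1 (σ.injective e)
  rcases h1.lt_or_gt with h | h <;> rcases h2.lt_or_gt with h' | h' <;>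
    simp [h, h', h.not_gt, h'.not_gt, neg_one_pow_mul_self]

/-- The sign of moving an element of degree `-1` from the slot `m` to the right end of the
permuted word. -/
def tailSign (m : Fin n) (σ : Equiv.Perm (Fin n)) (d : Fin n → ℕ) : ℤ :=
  ∏ p ∈ pairs n, if σ p.1 = m then (-1 : ℤ) ^ d (σ p.2) else 1

lemma tailSign_eq (m : Fin n) (σ : Equiv.Perm (Fin n)) (d : Fin n → ℕ) (q : Fin n)
    (hq : σ q = m) :
    tailSign m σ d = ∏ b : Fin n, if q < b then (-1 : ℤ) ^ d (σ b) else 1 := by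
  have h := prod_prod_ite (fun _ b => (-1 : ℤ) ^ d (σ b)) (fun a _ => σ a = m)
  rw [tailSign, ← h, Finset.prod_eq_single q]
  · simp [hq]
  · intro a _ ha
    refine Finset.prod_eq_one fun b _ => ?_
    have : σ a ≠ m := fun e => ha (σ.injective (e.trans hq.symm))
    simp [this]
  · simp

lemma koszulSign_mul_tailSign (m : Fin n) (σ : Equiv.Perm (Fin n)) (d : Fin n → ℕ) :
    koszulSign σ d * tailSign m σ d
      = koszulSign σ (Function.update d m (d m + 1)) * tailSign m 1 d := by
  have h := prod_pairs_perm σ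
    (fun a b => if a < b then (if a = m then (-1 : ℤ) ^ d b else 1)
      else (if b = m then (-1 : ℤ) ^ d a else 1)) (by
      intro a b
      rcases lt_trichotomy a b with hab | rfl | hab
      · simp [hab, hab.not_gt]
      · rfl
      · simp [hab, hab.not_gt])
  have h' : tailSign m 1 d = ∏ p ∈ pairs n,
      if p.1 < p.2 then (if p.1 = m then (-1 : ℤ) ^ d p.2 else 1)
      else (if p.2 = m then (-1 : ℤ) ^ d p.1 else 1) := by
    refine Finset.prod_congr rfl fun p hp => ?_
    rw [mem_pairs] at hp
    simp only [Equiv.Perm.one_apply, if_pos hp]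
    rfl
  rw [h', ← h, koszulSign_eq, koszulSign_eq, tailSign, ← Finset.prod_mul_distrib,
    ← Finset.prod_mul_distrib]
  refine Finset.prod_congr rfl fun p hp => ?_
  rw [mem_pairs] at hp
  have h1 : σ p.1 ≠ σ p.2 := fun e => hp.ne (σ.injective e)
  clear h h'
  generalize σ p.1 = a at h1 ⊢
  generalize σ p.2 = b at h1 ⊢
  by_cases ha : a = m
  · subst ha
    rcases h1.lt_or_gt with h | h
    · simp [h, h.not_gt]
    · simp [h, h.not_gt, h.ne, add_mul, pow_add]
  · by_cases hb : b = m
    · subst hb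
      rcases h1.lt_or_gt with h | h
      · simp [h, h.not_gt, ha]
      · simp [h, h.not_gt, ha, mul_add, pow_add, mul_assoc, neg_one_pow_mul_self]
    · simp [ha, hb]

lemma koszulSign_swap (i j : Fin n) (hij : (i : ℕ) + 1 = j) (d : Fin n → ℕ) :
    koszulSign (Equiv.swap i j) d = -(-1 : ℤ) ^ (d i * d j) := by
  have hlt : i < j := by rw [Fin.lt_def]; omega
  rw [koszulSign_eq, Finset.prod_eq_single (i, j)]
  · simp [hlt, mul_comm]
  · rintro ⟨a, b⟩ hp hne
    rw [mem_pairs] at hp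
    simp only at hp
    rw [if_neg]
    simp only [not_lt]
    have h1 : ¬ (a = i ∧ b = j) := by rintro ⟨rfl, rfl⟩; exact hne rfl
    simp only [Equiv.swap_apply_def]
    simp only [Fin.lt_def, Fin.le_def, Fin.ext_iff] at *
    split_ifs <;> omega
  · intro h; exact absurd (mem_pairs.2 hlt) h

end KoszulSign

noncomputable section

/-- If a multilinear map sends all tuples from given sets into a submodule, then it sends all tuples
from their additive spans into it. -/
lemma MultilinearMap.mem_of_forall_closure {R ι M N : Type*} [Fintype ι] [CommSemiring R]
    [AddCommGroup M] [Module R M] [AddCommGroup N] [Module R N]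
    (f : MultilinearMap R (fun _ : ι => M) N) (s : ι → Set M) (S : AddSubgroup N)
    (h : ∀ x : ι → M, (∀ i, x i ∈ s i) → f x ∈ S) (x : ι → M)
    (hx : ∀ i, x i ∈ AddSubmonoid.closure (s i)) : f x ∈ S := by
  classical
  suffices H : ∀ T : Finset ι, ∀ x : ι → M, (∀ i ∉ T, x i ∈ s i) →
      (∀ i ∈ T, x i ∈ AddSubmonoid.closure (s i)) → f x ∈ S from
    H Finset.univ x (by simp) fun i _ => hx i
  intro T
  induction T using Finset.induction_on with
  | empty => exact fun x h1 _ => h x fun i => h1 i (by simp)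
  | insert j T hj ih =>
    intro x h1 h2
    have key : ∀ y ∈ AddSubmonoid.closure (s j), f (Function.update x j y) ∈ S := by
      intro y hy
      induction hy using AddSubmonoid.closure_induction with
      | mem y hy =>
        refine ih _ (fun i hi => ?_) fun i hi => ?_
        · by_cases hij : i = j
          · subst hij; simpa using hy
          · rw [Function.update_of_ne hij]; exact h1 i (by simp [hij, hi])
        · rw [Function.update_of_ne (fun e : i = j => hj (e ▸ hi))]
          exact h2 i (by simp [hi])
      | zero => rw [f.map_update_zero]; exact S.zero_mem
      | add y z _ _ hy hz => rw [f.map_update_add]; exact S.add_mem hy hz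
    simpa using key (x j) (h2 j (by simp))

section PolyFun

variable {k : Type} {A : Type u} [Field k] [CharZero k] [CommRing A] [Algebra k A]
variable {V : Type v} {W : Type*} [AddCommGroup V] [Module k V] [Module A V] [IsScalarTower k A V]
  [AddCommGroup W] [Module k W] [Module A W] [IsScalarTower k A W]

/-- The monomial `t ↦ tⁱ v` as a function on `k`. -/
def monoFun (k : Type) (A : Type u) [Field k] [CommRing A] [Algebra k A] {V : Type v}
    [AddCommGroup V] [Module k V] [Module A V] [IsScalarTower k A V] (i : ℕ) : V →ₗ[A] (k → V) where
  toFun v t := t ^ i • v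
  map_add' v w := by ext t; simp
  map_smul' a v := by ext t; exact smul_comm _ _ _

variable (k A V) in
/-- The function on `k` defined by a polynomial with coefficients in `V`. -/
def polyEval : (ℕ →₀ V) →ₗ[A] (k → V) := Finsupp.lsum ℕ (monoFun k A)

omit [CharZero k] in
lemma polyEval_single (i : ℕ) (v : V) : polyEval k A V (Finsupp.single i v) = monoFun k A i v := by
  simp [polyEval]

lemma polyEval_injective : Function.Injective (polyEval k A V) := by
  rw [← LinearMap.ker_eq_bot, LinearMap.ker_eq_bot']
  intro p hp
  ext i
  rw [Finsupp.zero_apply, ← Module.forall_dual_apply_eq_zero_iff k]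
  intro φ
  have h0 : (p.sum fun i v => Polynomial.monomial i (φ v)) = 0 := by
    refine Polynomial.funext fun t => ?_
    have := congrArg φ (congrFun hp t)
    simp only [polyEval, Finsupp.lsum_apply, Finsupp.sum, Finset.sum_apply, map_sum, monoFun,
      LinearMap.coe_mk, AddHom.coe_mk, map_smul, smul_eq_mul, Pi.zero_apply, map_zero] at this
    simp only [Finsupp.sum, Polynomial.eval_finsetSum, Polynomial.eval_monomial,
      Polynomial.eval_zero]
    rw [← this]
    exact Finset.sum_congr rfl fun _ _ => mul_comm _ _
  have := congrArg (fun q => Polynomial.coeff q i) h0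
  simp only [Finsupp.sum, Polynomial.finsetSum_coeff, Polynomial.coeff_monomial,
    Polynomial.coeff_zero, Finset.sum_ite_eq', Finsupp.mem_support_iff] at this
  by_cases hi : p i = 0
  · simp [hi]
  · simpa [hi] using this

variable (k A V) in
/-- The polynomial functions from `k` to `V`. -/
def PolyFun : Submodule A (k → V) := LinearMap.range (polyEval k A V)

namespace PolyFun

variable (k A) in
/-- The monomial `t ↦ tⁱ v`. -/
def mono (i : ℕ) : V →ₗ[A] PolyFun k A V :=
  (monoFun k A i).codRestrict _ fun v => ⟨Finsupp.single i v, polyEval_single i v⟩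

omit [CharZero k] in
@[simp]
lemma mono_apply (i : ℕ) (v : V) (t : k) : (mono k A i v).1 t = t ^ i • v := rfl

omit [CharZero k] in
lemma mem_closure (f : PolyFun k A V) :
    f ∈ AddSubmonoid.closure {f : PolyFun k A V | ∃ i v, f = mono k A i v} := by
  obtain ⟨_, p, rfl⟩ := f
  induction p using Finsupp.induction_linear with
  | zero =>
    have : (⟨polyEval k A V 0, 0, rfl⟩ : PolyFun k A V) = 0 := Subtype.ext (map_zero _)
    rw [this]
    exact zero_mem _
  | add p q hp hq =>
    have : (⟨polyEval k A V (p + q), p + q, rfl⟩ : PolyFun k A V)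
      = ⟨polyEval k A V p, p, rfl⟩ + ⟨polyEval k A V q, q, rfl⟩ := Subtype.ext (map_add _ _ _)
    rw [this]
    exact add_mem hp hq
  | single i v => exact AddSubmonoid.subset_closure ⟨i, v, Subtype.ext (polyEval_single i v)⟩

omit [CharZero k] in
/-- Induction over polynomial functions. -/
lemma induction {P : PolyFun k A V → Prop} (h0 : P 0) (hadd : ∀ f g, P f → P g → P (f + g))
    (hmono : ∀ i v, P (mono k A i v)) (f : PolyFun k A V) : P f := by
  induction mem_closure f using AddSubmonoid.closure_induction with
  | mem f h => obtain ⟨i, v, rfl⟩ := h; exact hmono i v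
  | zero => exact h0
  | add f g _ _ hf hg => exact hadd f g hf hg

omit [CharZero k] in
lemma linearMap_ext {N : Type*} [AddCommGroup N] [Module A N] {f g : PolyFun k A V →ₗ[A] N}
    (h : ∀ i v, f (mono k A i v) = g (mono k A i v)) : f = g := by
  ext p
  induction p using PolyFun.induction with
  | h0 => simp
  | hadd p q hp hq => rw [map_add, map_add, hp, hq]
  | hmono i v => exact h i v

omit [CharZero k] in
@[ext]
lemma ext {f g : PolyFun k A V} (h : ∀ t, f.1 t = g.1 t) : f = g := Subtype.ext (funext h)

variable (k A V) in
/-- Polynomial functions are polynomials. -/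
def equiv : (ℕ →₀ V) ≃ₗ[A] PolyFun k A V :=
  LinearEquiv.ofInjective _ polyEval_injective

lemma equiv_single (i : ℕ) (v : V) : equiv k A V (Finsupp.single i v) = mono k A i v :=
  Subtype.ext (polyEval_single i v)

/-- The linear map given on monomials by linear maps on coefficients. -/
def lift {N : Type*} [AddCommGroup N] [Module A N] (F : ℕ → V →ₗ[A] N) :
    PolyFun k A V →ₗ[A] N :=
  (Finsupp.lsum ℕ F : (ℕ →₀ V) →ₗ[A] N) ∘ₗ (equiv k A V).symm.toLinearMap

@[simp]
lemma lift_mono {N : Type*} [AddCommGroup N] [Module A N] (F : ℕ → V →ₗ[A] N) (i : ℕ) (v : V) :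
    lift F (mono k A i v) = F i v := by
  rw [← equiv_single]; simp [lift]

/-- evaluation at a point -/
def eval (t : k) : PolyFun k A V →ₗ[A] V := (LinearMap.proj t).comp (PolyFun k A V).subtype

omit [CharZero k] in
@[simp]
lemma eval_apply (t : k) (f : PolyFun k A V) : eval t f = f.1 t := rfl

/-- The derivative of a polynomial function. -/
def der : PolyFun k A V →ₗ[A] PolyFun k A V :=
  lift fun i => (i : k) • mono k A (i - 1)

@[simp]
lemma der_mono (i : ℕ) (v : V) : der (mono k A i v) = (i : k) • mono k A (i - 1) v := by
  simp [der]

/-- The primitive of a polynomial function that vanishes at `0`. -/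
def int : PolyFun k A V →ₗ[A] PolyFun k A V :=
  lift fun i => ((i : k) + 1)⁻¹ • mono k A (i + 1)

@[simp]
lemma int_mono (i : ℕ) (v : V) :
    int (mono k A i v) = ((i : k) + 1)⁻¹ • mono k A (i + 1) v := by
  simp [int]

omit [CommRing A] [Algebra k A] in
lemma inv_add_one_mul (i : ℕ) : ((i : k) + 1)⁻¹ * ((i : k) + 1) = 1 :=
  inv_mul_cancel₀ (by exact_mod_cast Nat.succ_ne_zero i)

@[simp]
lemma der_int (f : PolyFun k A V) : der (int f) = f := by
  have : (der ∘ₗ int : PolyFun k A V →ₗ[A] PolyFun k A V) = LinearMap.id :=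
    linearMap_ext fun i v => by
      simp [smul_smul, inv_add_one_mul]
  exact LinearMap.congr_fun this f

lemma int_der (f : PolyFun k A V) : int (der f) = f - mono k A 0 (f.1 0) := by
  have : (int ∘ₗ der : PolyFun k A V →ₗ[A] PolyFun k A V)
      = LinearMap.id - mono k A 0 ∘ₗ eval 0 :=
    linearMap_ext fun i v => by
      cases i with
      | zero => ext t; simp
      | succ i => 
        ext t
        simp [smul_smul, mul_comm ((i : k) + 1), inv_add_one_mul]
  exact LinearMap.congr_fun this f

@[simp]
lemma int_apply_zero (f : PolyFun k A V) : (int f).1 0 = 0 := by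
  have : (eval 0 ∘ₗ int : PolyFun k A V →ₗ[A] V) = 0 := linearMap_ext fun i v => by simp
  exact LinearMap.congr_fun this f

lemma eq_of_der_eq_zero {f : PolyFun k A V} (h : der f = 0) (t : k) : f.1 t = f.1 0 := by
  have := int_der f
  rw [h, map_zero, eq_comm, sub_eq_zero] at this
  conv_lhs => rw [this]
  simp

omit [CharZero k] in
lemma comp_mem (g : V →ₗ[A] W) (f : PolyFun k A V) : (fun t => g (f.1 t)) ∈ PolyFun k A W := by
  induction f using PolyFun.induction with
  | h0 => simp only [ZeroMemClass.coe_zero, Pi.zero_apply, map_zero]; exact (PolyFun k A W).zero_mem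
  | hadd p q hp hq => simpa using! (PolyFun k A W).add_mem hp hq
  | hmono i v =>
    convert (mono k A i (g v)).2 using 1
    ext t
    exact g.map_smul_of_tower (t ^ i) v

/-- Postcomposition with a linear map. -/
def map (g : V →ₗ[A] W) : PolyFun k A V →ₗ[A] PolyFun k A W where
  toFun f := ⟨fun t => g (f.1 t), comp_mem g f⟩
  map_add' f g := by ext t; simp
  map_smul' a f := by ext t; simp

omit [CharZero k] in
@[simp]
lemma map_apply (g : V →ₗ[A] W) (f : PolyFun k A V) (t : k) : (map g f).1 t = g (f.1 t) := rfl

omit [CharZero k] in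
lemma map_mono (g : V →ₗ[A] W) (i : ℕ) (v : V) : map g (mono k A i v) = mono k A i (g v) := by
  ext t
  exact g.map_smul_of_tower (t ^ i) v

lemma der_map (g : V →ₗ[A] W) (f : PolyFun k A V) : der (map g f) = map g (der f) := by
  have : (der ∘ₗ map g : PolyFun k A V →ₗ[A] PolyFun k A W) = map g ∘ₗ der :=
    linearMap_ext fun i v => by simp [map_mono]
  exact LinearMap.congr_fun this f

lemma int_map (g : V →ₗ[A] W) (f : PolyFun k A V) : int (map g f) = map g (int f) := by
  have : (int ∘ₗ map g : PolyFun k A V →ₗ[A] PolyFun k A W) = map g ∘ₗ int :=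
    linearMap_ext fun i v => by simp [map_mono]
  exact LinearMap.congr_fun this f

variable {ι : Type} [Fintype ι]

omit [CharZero k] in
lemma multilinear_mono (g : MultilinearMap k (fun _ : ι => V) W) (e : ι → ℕ) (v : ι → V) (t : k) :
    g (fun i => (mono k A (e i) (v i)).1 t) = (mono k A (∑ i, e i) (g v)).1 t := by
  simp [g.map_smul_univ, Finset.prod_pow_eq_pow_sum]

omit [CharZero k] in
lemma multilinear_mem (g : MultilinearMap k (fun _ : ι => V) W) (f : ι → PolyFun k A V) :
    (fun t => g fun i => (f i).1 t) ∈ PolyFun k A W := by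
  let G : MultilinearMap k (fun _ : ι => PolyFun k A V) (k → W) :=
    MultilinearMap.pi fun t => g.compLinearMap fun _ => (eval t).restrictScalars k
  refine G.mem_of_forall_closure _ (PolyFun k A W).toAddSubgroup ?_ f fun i => mem_closure (f i)
  intro x hx
  choose e v hx using hx
  obtain rfl : x = fun i => mono k A (e i) (v i) := funext hx
  have : G (fun i => mono k A (e i) (v i)) = (mono k A (∑ i, e i) (g v)).1 :=
    funext fun t => multilinear_mono g e v t
  rw [this]
  exact (mono k A (∑ i, e i) (g v)).2

/-- The pointwise extension of a multilinear map to polynomial functions. -/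
def mapMul (g : MultilinearMap k (fun _ : ι => V) W) :
    MultilinearMap k (fun _ : ι => PolyFun k A V) (PolyFun k A W) :=
  MultilinearMap.codRestrict
    (MultilinearMap.pi fun t => g.compLinearMap fun _ => (eval t).restrictScalars k)
    ((PolyFun k A W).restrictScalars k) fun f => multilinear_mem g f

omit [CharZero k] in
@[simp]
lemma mapMul_apply (g : MultilinearMap k (fun _ : ι => V) W) (f : ι → PolyFun k A V) (t : k) :
    (mapMul g f).1 t = g fun i => (f i).1 t := rfl

omit [CharZero k] in
lemma mapMul_mono (g : MultilinearMap k (fun _ : ι => V) W) (e : ι → ℕ) (v : ι → V) :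
    mapMul g (fun i => mono k A (e i) (v i)) = mono k A (∑ i, e i) (g v) :=
  ext fun t => multilinear_mono g e v t

/-- The product rule. -/
lemma der_mapMul [DecidableEq ι] (g : MultilinearMap k (fun _ : ι => V) W)
    (f : ι → PolyFun k A V) :
    der (mapMul g f) = ∑ i, mapMul g (Function.update f i (der (f i))) := by
  let G : MultilinearMap k (fun _ : ι => PolyFun k A V) (PolyFun k A W) :=
    (der.restrictScalars k).compMultilinearMap (mapMul g) -
      ∑ i, (mapMul g).compLinearMap fun j =>
        if j = i then der.restrictScalars k else LinearMap.id
  have hG : ∀ f, G f = der (mapMul g f) - ∑ i, mapMul g (Function.update f i (der (f i))) := by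
    intro f
    simp only [G, sub_apply, sum_apply,
      MultilinearMap.compLinearMap_apply]
    congr 1
    refine Finset.sum_congr rfl fun i _ => congrArg _ (funext fun j => ?_)
    by_cases h : j = i
    · subst h; simp
    · simp [h]
  rw [← sub_eq_zero, ← hG]
  refine (AddSubgroup.mem_bot).1
    (G.mem_of_forall_closure _ ⊥ ?_ f fun i => mem_closure (f i))
  intro x hx
  choose e v hx using hx
  obtain rfl : x = fun i => mono k A (e i) (v i) := funext hx
  rw [AddSubgroup.mem_bot, hG, mapMul_mono, der_mono, sub_eq_zero]
  have : ∀ i, mapMul g (Function.update (fun i => mono k A (e i) (v i)) i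
      (der (mono k A (e i) (v i)))) = (e i : k) • mono k A ((∑ i, e i) - 1) (g v) := by
    intro i
    rw [der_mono, MultilinearMap.map_update_smul]
    rcases Nat.eq_zero_or_pos (e i) with h0 | hpos
    · simp [h0]
    · have h1 : Function.update (fun i => mono k A (e i) (v i)) i (mono k A (e i - 1) (v i))
          = fun j => mono k A (Function.update e i (e i - 1) j) (v j) := by
        ext j
        by_cases h : j = i
        · subst h; simp
        · simp [h]
      have h2 : ∑ j, Function.update e i (e i - 1) j = (∑ j, e j) - 1 := by
        rw [Finset.sum_update_of_mem (Finset.mem_univ i), ← Finset.add_sum_erase _ e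
          (Finset.mem_univ i), Finset.sdiff_singleton_eq_erase]
        omega
      rw [h1, mapMul_mono, h2]
  rw [Finset.sum_congr rfl fun i _ => this i, ← Finset.sum_smul]
  simp

end PolyFun

end PolyFun

/-- A sequence of submodules with a complete system of projections is a grading. -/
lemma isInternal_of_proj {R M : Type*} [CommRing R] [AddCommGroup M] [Module R M]
    (deg : ℕ → Submodule R M) (π : ℕ → M →ₗ[R] M) (h1 : ∀ n x, π n x ∈ deg n)
    (h2 : ∀ n, ∀ x ∈ deg n, π n x = x) (h3 : ∀ m n, m ≠ n → ∀ x ∈ deg m, π n x = 0)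
    (h4 : ∀ x, ∃ N, x = ∑ n ∈ Finset.range N, π n x) : DirectSum.IsInternal deg := by
  classical
  have key : ∀ (y : DirectSum ℕ fun n => deg n) (n : ℕ),
      π n (DirectSum.coeAddMonoidHom deg y) = y n := by
    intro y n
    induction y using DirectSum.induction_on with
    | zero => simp
    | of i x =>
      rw [DirectSum.coeAddMonoidHom_of]
      by_cases h : i = n
      · subst h
        rw [h2 _ _ x.2, DirectSum.of_eq_same]
      · rw [h3 i n h _ x.2, DirectSum.of_eq_of_ne _ _ _ (Ne.symm h)]
        rfl
    | add x y hx hy => simp [hx, hy]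
  refine ⟨fun x y h => ?_, fun x => ?_⟩
  · refine DFinsupp.ext fun n => Subtype.ext ?_
    exact (key x n).symm.trans ((congrArg (π n) h).trans (key y n))
  · obtain ⟨N, hN⟩ := h4 x
    refine ⟨∑ n ∈ Finset.range N, DirectSum.of (fun n => deg n) n ⟨π n x, h1 n x⟩, ?_⟩
    rw [map_sum]
    conv_rhs => rw [hN]
    exact Finset.sum_congr rfl fun n _ => DirectSum.coeAddMonoidHom_of _ _ _

@[to_additive]
lemma Fin.prod_univ_split {M : Type*} [CommMonoid M] {n i j : ℕ} (h : i + j = n) (f : Fin n → M) :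
    ∏ q : Fin n, f q = (∏ a : Fin i, f ⟨a, by omega⟩) * ∏ b : Fin j, f ⟨i + b, by omega⟩ := by
  subst h
  rw [Fin.prod_univ_add]
  rfl

section Nested

variable {k : Type w} [Field k] {V : Type v} [AddCommGroup V] [Module k V]
  (β : (n : ℕ) → MultilinearMap k (fun _ : Fin n => V) V)

/-- The bracket of the first `i` arguments, followed by the bracket with the others. -/
def nestedBr (n : ℕ) (i : Fin (n + 1)) (x : Fin n → V) : V :=
  β (n - (i : ℕ) + 1) (Fin.cons (β i fun a : Fin (i : ℕ) => x ⟨a, by omega⟩)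
    fun b : Fin (n - (i : ℕ)) => x ⟨(i : ℕ) + b, by omega⟩)

/-- The left-hand side of the Jacobi identity. -/
def jacobiator (n : ℕ) (d : Fin n → ℕ) (x : Fin n → V) : V :=
  ∑ i : Fin (n + 1), (-1 : ℤ) ^ ((i : ℕ) * (n - (i : ℕ))) •
    ∑ σ : Equiv.Perm (Fin n) with IsUnshuffle i σ, koszulSign σ d • nestedBr β n i (x ∘ σ)

lemma map_zsmul_univ {ι : Type*} [Fintype ι] (f : MultilinearMap k (fun _ : ι => V) V) (c : ι → ℤ)
    (x : ι → V) : f (fun b => c b • x b) = (∏ b, c b) • f x := by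
  have := f.map_smul_univ (fun b => (c b : k)) x
  simpa only [Int.cast_smul_eq_zsmul, ← Int.cast_prod] using this

lemma nestedBr_zsmul (n : ℕ) (i : Fin (n + 1)) (c : Fin n → ℤ) (x : Fin n → V) :
    nestedBr β n i (fun b => c b • x b) = (∏ b, c b) • nestedBr β n i x := by
  have e : (Fin.cons (β i fun a : Fin (i : ℕ) => c ⟨a, by omega⟩ • x ⟨a, by omega⟩)
      fun b : Fin (n - (i : ℕ)) => c ⟨(i : ℕ) + b, by omega⟩ • x ⟨(i : ℕ) + b, by omega⟩ :
        Fin (n - (i : ℕ) + 1) → V)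
      = fun j => (Fin.cons (∏ a : Fin (i : ℕ), c ⟨a, by omega⟩)
          fun b : Fin (n - (i : ℕ)) => c ⟨(i : ℕ) + b, by omega⟩ : Fin (n - (i : ℕ) + 1) → ℤ) j •
        (Fin.cons (β i fun a : Fin (i : ℕ) => x ⟨a, by omega⟩)
          fun b : Fin (n - (i : ℕ)) => x ⟨(i : ℕ) + b, by omega⟩ : Fin (n - (i : ℕ) + 1) → V) j := by
    ext j
    refine Fin.cases ?_ (fun b => ?_) j
    · simp only [Fin.cons_zero]
      exact map_zsmul_univ _ (fun a : Fin (i : ℕ) => c ⟨a, by omega⟩) _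
    · simp
  unfold nestedBr
  rw [e, map_zsmul_univ, Fin.prod_cons, Fin.prod_univ_split (i := i) (j := n - i) (by omega) c]

lemma map_nestedBr {W : Type*} [AddCommGroup W] [Module k W]
    {β' : (n : ℕ) → MultilinearMap k (fun _ : Fin n => W) W} (g : V →+ W)
    (hg : ∀ n x, g (β n x) = β' n fun b => g (x b)) (n : ℕ) (i : Fin (n + 1)) (x : Fin n → V) :
    g (nestedBr β n i x) = nestedBr β' n i fun b => g (x b) := by
  unfold nestedBr
  rw [hg]
  congr 1
  ext j
  refine Fin.cases ?_ (fun b => ?_) j <;> simp [hg]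

lemma map_jacobiator {W : Type*} [AddCommGroup W] [Module k W]
    {β' : (n : ℕ) → MultilinearMap k (fun _ : Fin n => W) W} (g : V →+ W)
    (hg : ∀ n x, g (β n x) = β' n fun b => g (x b)) (n : ℕ) (d : Fin n → ℕ) (x : Fin n → V) :
    g (jacobiator β n d x) = jacobiator β' n d fun b => g (x b) := by
  simp only [jacobiator, map_sum, map_zsmul, map_nestedBr β g hg]
  rfl

end Nested

section Unshuffle

lemma isUnshuffle_self_iff {n : ℕ} (σ : Equiv.Perm (Fin n)) : IsUnshuffle n σ ↔ σ = 1 := by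
  constructor
  · intro h
    have h1 : StrictMono σ := fun a b hab => h.1 a b hab b.2
    have := (StrictMono.range_inj h1 strictMono_id).1 (by simp [σ.surjective.range_eq])
    exact Equiv.ext (congrFun this)
  · rintro rfl
    exact ⟨fun a b hab _ => hab, fun a b hab _ => hab⟩

lemma sum_isUnshuffle_self {M : Type*} [AddCommMonoid M] {n : ℕ} (F : Equiv.Perm (Fin n) → M) :
    ∑ σ : Equiv.Perm (Fin n) with IsUnshuffle n σ, F σ = F 1 := by
  rw [Finset.sum_filter, Finset.sum_eq_single 1]
  · simp [(isUnshuffle_self_iff (1 : Equiv.Perm (Fin n))).2 rfl]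
  · intro σ _ h
    rw [if_neg (mt (isUnshuffle_self_iff σ).1 h)]
  · simp

lemma isUnshuffle_one_iff {n : ℕ} (σ : Equiv.Perm (Fin (n + 1))) :
    IsUnshuffle 1 σ ↔ σ = (σ 0).cycleRange.symm := by
  constructor
  · intro h
    have h1 : StrictMono fun b : Fin n => σ b.succ := fun a b hab =>
      h.2 _ _ (Fin.succ_lt_succ_iff.2 hab) (by simp)
    have := (StrictMono.range_inj h1 (Fin.strictMono_succAbove (σ 0))).1 (by
      rw [Fin.range_succAbove]
      ext c
      simp only [Set.mem_range, Set.mem_compl_iff, Set.mem_singleton_iff]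
      constructor
      · rintro ⟨b, rfl⟩ e
        exact Fin.succ_ne_zero b (σ.injective e)
      · intro hc
        obtain ⟨a, rfl⟩ := σ.surjective c
        obtain ⟨b, rfl⟩ := Fin.exists_succ_eq.2 fun e : a = 0 => hc (by rw [e])
        exact ⟨b, rfl⟩)
    ext1 c
    refine Fin.cases ?_ (fun b => ?_) c
    · rw [Fin.cycleRange_symm_zero]
    · rw [Fin.cycleRange_symm_succ]
      exact congrFun this b
  · intro h
    refine ⟨fun a b hab hb => ?_, fun a b hab ha => ?_⟩
    · rw [Fin.lt_def] at hab
      omega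
    · have h0 : a ≠ 0 := fun e => by simp [e] at ha
      obtain ⟨a, rfl⟩ := Fin.exists_succ_eq.2 h0
      obtain ⟨b, rfl⟩ := Fin.exists_succ_eq.2 (hab.trans_le' (Fin.zero_le _)).ne'
      rw [h, Fin.cycleRange_symm_succ, Fin.cycleRange_symm_succ]
      exact Fin.strictMono_succAbove _ (Fin.succ_lt_succ_iff.1 hab)

lemma sum_isUnshuffle_one {M : Type*} [AddCommMonoid M] {n : ℕ} (F : Fin (n + 1) → M) :
    ∑ σ : Equiv.Perm (Fin (n + 1)) with IsUnshuffle 1 σ, F (σ 0) = ∑ m, F m := by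
  refine Finset.sum_nbij' (fun σ => σ 0) (fun m => m.cycleRange.symm) (by simp) ?_ ?_ ?_ (by simp)
  · intro m _
    rw [Finset.mem_filter, isUnshuffle_one_iff, Fin.cycleRange_symm_zero]
    exact ⟨Finset.mem_univ _, rfl⟩
  · intro σ hσ
    exact ((isUnshuffle_one_iff σ).1 (Finset.mem_filter.1 hσ).2).symm
  · intro m _
    exact Fin.cycleRange_symm_zero m

end Unshuffle

namespace LInfAlgebroid

variable {k : Type} {A : Type u} [Field k] [CommRing A] [Algebra k A]
variable (L L' : LInfAlgebroid.{0, u, v} k A)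

/-- The decomposition into homogeneous components. -/
def decomp : (DirectSum ℕ fun n => L.deg n) ≃ₗ[A] L :=
  LinearEquiv.ofBijective (DirectSum.coeLinearMap L.deg) L.isInternal

/-- The projection to the homogeneous component of degree `n`. -/
def proj (n : ℕ) : L →ₗ[A] L :=
  (L.deg n).subtype ∘ₗ DirectSum.component A ℕ (fun n => L.deg n) n ∘ₗ L.decomp.symm.toLinearMap

/-- The automorphism that is multiplication by `(-1)ⁿ` in degree `n`. -/
def sgn : L →ₗ[A] L :=
  DirectSum.toModule A ℕ L (fun n => (-1 : ℤ) ^ n • (L.deg n).subtype) ∘ₗ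
    L.decomp.symm.toLinearMap

variable {L L'}

lemma decomp_symm_of_mem {n : ℕ} {x : L} (hx : x ∈ L.deg n) :
    L.decomp.symm x = DirectSum.lof A ℕ (fun n => L.deg n) n ⟨x, hx⟩ := by
  rw [LinearEquiv.symm_apply_eq]
  exact (DirectSum.coeAddMonoidHom_of L.deg n ⟨x, hx⟩).symm

lemma proj_mem (n : ℕ) (x : L) : L.proj n x ∈ L.deg n := by simp [proj]

lemma proj_of_mem {n : ℕ} {x : L} (hx : x ∈ L.deg n) : L.proj n x = x := by
  simp [proj, decomp_symm_of_mem hx]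

lemma proj_of_mem_of_ne {m n : ℕ} (h : m ≠ n) {x : L} (hx : x ∈ L.deg m) : L.proj n x = 0 := by
  simp [proj, decomp_symm_of_mem hx, DirectSum.component.of, h]

lemma sgn_of_mem {n : ℕ} {x : L} (hx : x ∈ L.deg n) : L.sgn x = (-1 : ℤ) ^ n • x := by
  simp [sgn, decomp_symm_of_mem hx]

lemma mem_closure (x : L) : x ∈ AddSubmonoid.closure {x : L | ∃ n, x ∈ L.deg n} := by
  obtain ⟨y, rfl⟩ := L.decomp.surjective x
  induction y using DirectSum.induction_on with
  | zero => rw [map_zero]; exact zero_mem _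
  | of i x =>
    refine AddSubmonoid.subset_closure ⟨i, ?_⟩
    have : L.decomp (DirectSum.of (fun n => L.deg n) i x) = x :=
      DirectSum.coeAddMonoidHom_of _ _ _
    rw [this]
    exact x.2
  | add x y hx hy => rw [map_add]; exact add_mem hx hy

/-- Induction over sums of homogeneous elements. -/
lemma induction_homogeneous {P : L → Prop} (h0 : P 0) (hadd : ∀ x y, P x → P y → P (x + y))
    (hdeg : ∀ n, ∀ x ∈ L.deg n, P x) (x : L) : P x := by
  induction mem_closure x using AddSubmonoid.closure_induction with
  | mem x h => obtain ⟨n, hx⟩ := h; exact hdeg n x hx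
  | zero => exact h0
  | add x y _ _ hx hy => exact hadd x y hx hy

lemma linearMap_ext {N : Type*} [AddCommGroup N] [Module A N] {f g : L →ₗ[A] N}
    (h : ∀ n, ∀ x ∈ L.deg n, f x = g x) : f = g := by
  ext x
  induction x using induction_homogeneous with
  | h0 => simp
  | hadd x y hx hy => rw [map_add, map_add, hx, hy]
  | hdeg n x hx => exact h n x hx

lemma sum_proj (x : L) : ∃ N₀, ∀ N, N₀ ≤ N → x = ∑ n ∈ Finset.range N, L.proj n x := by
  induction x using induction_homogeneous with
  | h0 => exact ⟨0, by simp⟩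
  | hadd x y hx hy =>
    obtain ⟨N, hN⟩ := hx
    obtain ⟨N', hN'⟩ := hy
    refine ⟨max N N', fun M hM => ?_⟩
    simp only [map_add, Finset.sum_add_distrib]
    rw [← hN M (le_of_max_le_left hM), ← hN' M (le_of_max_le_right hM)]
  | hdeg n x hx =>
    refine ⟨n + 1, fun N hN => ?_⟩
    rw [Finset.sum_eq_single n, proj_of_mem hx]
    · exact fun m _ hm => proj_of_mem_of_ne hm.symm hx
    · intro h; exact absurd (Finset.mem_range.2 (by omega)) h

lemma sgn_sgn (x : L) : L.sgn (L.sgn x) = x := by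
  have : L.sgn ∘ₗ L.sgn = LinearMap.id := linearMap_ext fun n x hx => by
    simp [sgn_of_mem hx, smul_smul, KoszulSign.neg_one_pow_mul_self]
  exact LinearMap.congr_fun this x

lemma sgn_mem {n : ℕ} {x : L} (hx : x ∈ L.deg n) : L.sgn x ∈ L.deg n := by
  rw [sgn_of_mem hx]
  exact zsmul_mem hx _

lemma diff_mem {n : ℕ} {x : L} (hx : x ∈ L.deg (n + 1)) : L.diff x ∈ L.deg n :=
  L.br_mem 1 (fun _ => n + 1) ![x] (fun i => by fin_cases i; exact hx) n (by simp)

lemma diff_of_mem_zero {x : L} (hx : x ∈ L.deg 0) : L.diff x = 0 :=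
  L.br_eq_zero 1 (fun _ => 0) ![x] (fun i => by fin_cases i; exact hx) (by simp)

lemma br_zero_eq (x : Fin 0 → L) : L.br 0 x = 0 :=
  L.br_eq_zero 0 (fun _ => 0) x (fun i => i.elim0) (by simp)

lemma diff_sgn (x : L) : L.diff (L.sgn x) = - L.sgn (L.diff x) := by
  have : L.diff ∘ₗ L.sgn = - (L.sgn ∘ₗ L.diff) := linearMap_ext fun n x hx => by
    cases n with
    | zero => simp [sgn_of_mem hx, diff_of_mem_zero hx]
    | succ n => simp [sgn_of_mem hx, sgn_of_mem (diff_mem hx), pow_succ]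
  exact LinearMap.congr_fun this x

lemma diff_proj (n : ℕ) (x : L) : L.diff (L.proj (n + 1) x) = L.proj n (L.diff x) := by
  have : L.diff ∘ₗ L.proj (n + 1) = L.proj n ∘ₗ L.diff := linearMap_ext fun m x hx => by
    cases m with
    | zero => simp [proj_of_mem_of_ne (Nat.succ_ne_zero n).symm hx, diff_of_mem_zero hx]
    | succ m =>
      by_cases h : m = n
      · subst h; simp [proj_of_mem hx, proj_of_mem (diff_mem hx)]
      · simp [proj_of_mem_of_ne (fun e => h (Nat.succ_injective e)) hx,
          proj_of_mem_of_ne h (diff_mem hx)]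
  exact LinearMap.congr_fun this x

lemma proj_proj_of_ne {m n : ℕ} (h : m ≠ n) (x : L) : L.proj n (L.proj m x) = 0 :=
  proj_of_mem_of_ne h (proj_mem m x)

lemma proj_sgn (n : ℕ) (x : L) : L.proj n (L.sgn x) = L.sgn (L.proj n x) := by
  have : L.proj n ∘ₗ L.sgn = L.sgn ∘ₗ L.proj n := linearMap_ext fun m x hx => by
    by_cases h : m = n
    · subst h; simp [proj_of_mem hx, proj_of_mem (sgn_mem hx)]
    · simp [proj_of_mem_of_ne h hx, proj_of_mem_of_ne h (sgn_mem hx)]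
  exact LinearMap.congr_fun this x

lemma Hom.map_proj (f : Hom L L') (n : ℕ) (x : L) :
    f.toLin (L.proj n x) = L'.proj n (f.toLin x) := by
  have : f.toLin ∘ₗ L.proj n = L'.proj n ∘ₗ f.toLin := linearMap_ext fun m x hx => by
    by_cases h : m = n
    · subst h; simp [proj_of_mem hx, proj_of_mem (f.map_deg _ _ hx)]
    · simp [proj_of_mem_of_ne h hx, proj_of_mem_of_ne h (f.map_deg _ _ hx)]
  exact LinearMap.congr_fun this x

lemma Hom.map_sgn (f : Hom L L') (x : L) : f.toLin (L.sgn x) = L'.sgn (f.toLin x) := by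
  have : f.toLin ∘ₗ L.sgn = L'.sgn ∘ₗ f.toLin := linearMap_ext fun m x hx => by
    simp [sgn_of_mem hx, sgn_of_mem (f.map_deg _ _ hx)]
  exact LinearMap.congr_fun this x

lemma anchor_proj_zero (x : L) : L.anchor (L.proj 0 x) = L.anchor x := by
  have : L.anchor ∘ₗ L.proj 0 = L.anchor := linearMap_ext fun m x hx => by
    rcases Nat.eq_zero_or_pos m with rfl | h
    · simp [proj_of_mem hx]
    · simp [proj_of_mem_of_ne h.ne' hx, L.anchor_of_pos m h x hx]
  exact LinearMap.congr_fun this x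

lemma jacobiator_br (n : ℕ) (d : Fin n → ℕ) (x : Fin n → L) (hx : ∀ i, x i ∈ L.deg (d i)) :
    jacobiator L.br n d x = 0 := L.jacobi n d x hx

/-- Graded antisymmetry for all permutations. -/
lemma br_perm (n : ℕ) (σ : Equiv.Perm (Fin n)) (d : Fin n → ℕ) (x : Fin n → L)
    (hx : ∀ i, x i ∈ L.deg (d i)) : L.br n (x ∘ σ) = koszulSign σ d • L.br n x := by
  cases n with
  | zero => simp [br_zero_eq]
  | succ n =>
    have hσ : σ ∈ Submonoid.closure
        (Set.range fun i : Fin n => Equiv.swap i.castSucc i.succ) := by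
      rw [Equiv.Perm.mclosure_swap_castSucc_succ]; trivial
    induction hσ using Submonoid.closure_induction generalizing d x with
    | mem σ h =>
      obtain ⟨i, rfl⟩ := h
      rw [L.br_swap _ d x hx _ _ (by simp), KoszulSign.koszulSign_swap _ _ (by simp)]
    | one => simp
    | mul σ τ _ _ hσ hτ =>
      rw [Equiv.Perm.coe_mul, ← Function.comp_assoc, hτ (d ∘ σ) (x ∘ σ) (fun i => hx _),
        hσ d x hx, KoszulSign.koszulSign_mul, smul_smul, mul_comm]

end LInfAlgebroid

lemma KoszulSign.koszulSign_mul_self {n : ℕ} (σ : Equiv.Perm (Fin n)) (d : Fin n → ℕ) :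
    koszulSign σ d * koszulSign σ d = 1 := by
  rw [koszulSign_eq, ← Finset.prod_mul_distrib]
  refine Finset.prod_eq_one fun p _ => ?_
  split_ifs <;> simp [neg_one_pow_mul_self]

namespace LInfAlgebroid

variable {k : Type} {A : Type u} [Field k] [CommRing A] [Algebra k A]
variable (L L' : LInfAlgebroid.{0, u, v} k A)

/-- The maps `x + y ε ↦ x`, `y`, `±x` according to whether the slot `b` is before, at, or after
the slot `q` of `ε`. -/
def epsSlot {n : ℕ} (q b : Fin n) : (L × L) →ₗ[A] L :=
  if b < q then LinearMap.fst A L L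
  else if b = q then LinearMap.snd A L L else L.sgn ∘ₗ LinearMap.fst A L L

/-- The brackets of `L ⊗ k[ε]` for `ε` of degree `-1` and square zero, an element of which is a pair
`(x, y)` that stands for `x + y ε`. -/
def epsBr (n : ℕ) : MultilinearMap k (fun _ : Fin n => L × L) (L × L) :=
  ((L.br n).compLinearMap fun _ => (LinearMap.fst A L L).restrictScalars k).prod
    (∑ q, (L.br n).compLinearMap fun b => (L.epsSlot q b).restrictScalars k)

variable {L L'}

@[simp]
lemma epsBr_fst (n : ℕ) (z : Fin n → L × L) : (L.epsBr n z).1 = L.br n fun b => (z b).1 := rfl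

lemma epsBr_snd (n : ℕ) (z : Fin n → L × L) :
    (L.epsBr n z).2 = ∑ q, L.br n fun b => L.epsSlot q b (z b) := by
  simp [epsBr]

lemma epsSlot_of_lt {n : ℕ} {q b : Fin n} (h : b < q) (z : L × L) : L.epsSlot q b z = z.1 := by
  simp [epsSlot, h]

@[simp]
lemma epsSlot_self {n : ℕ} (q : Fin n) (z : L × L) : L.epsSlot q q z = z.2 := by
  simp [epsSlot]

lemma epsSlot_of_gt {n : ℕ} {q b : Fin n} (h : q < b) (z : L × L) :
    L.epsSlot q b z = L.sgn z.1 := by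
  simp [epsSlot, h.not_gt, h.ne']

/-- The tuple of the first components, with the second component at one slot. -/
def epsTuple {n : ℕ} (z : Fin n → L × L) (m : Fin n) : Fin n → L :=
  Function.update (fun b => (z b).1) m (z m).2

lemma epsTuple_mem {n : ℕ} {d : Fin n → ℕ} {z : Fin n → L × L}
    (h1 : ∀ b, (z b).1 ∈ L.deg (d b)) (h2 : ∀ b, (z b).2 ∈ L.deg (d b + 1)) (m b : Fin n) :
    epsTuple z m b ∈ L.deg (Function.update d m (d m + 1) b) := by
  unfold epsTuple
  by_cases h : b = m
  · subst h; simpa using h2 b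
  · simpa [h] using h1 b

lemma epsSlot_perm {n : ℕ} (σ : Equiv.Perm (Fin n)) {d : Fin n → ℕ} {z : Fin n → L × L}
    (h1 : ∀ b, (z b).1 ∈ L.deg (d b)) (q : Fin n) :
    (fun b => L.epsSlot q b (z (σ b)))
      = fun b => (if q < b then (-1 : ℤ) ^ d (σ b) else 1) • (epsTuple z (σ q) ∘ σ) b := by
  ext b
  rcases lt_trichotomy b q with h | rfl | h
  · rw [epsSlot_of_lt h, if_neg h.not_gt]
    simp [epsTuple, h.ne]
  · simp [epsTuple]
  · rw [epsSlot_of_gt h, if_pos h, sgn_of_mem (h1 _)]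
    simp [epsTuple, h.ne']

lemma nestedBr_epsBr_fst (n : ℕ) (i : Fin (n + 1)) (z : Fin n → L × L) :
    (nestedBr L.epsBr n i z).1 = nestedBr L.br n i fun b => (z b).1 := by
  unfold nestedBr
  rw [epsBr_fst]
  congr 1
  ext j
  refine Fin.cases ?_ (fun b => ?_) j <;> simp

lemma nestedBr_epsBr_snd (n : ℕ) (i : Fin (n + 1)) (z : Fin n → L × L) :
    (nestedBr L.epsBr n i z).2
      = ∑ q, nestedBr L.br n i fun b => L.epsSlot q b (z b) := by
  rw [Fin.sum_univ_split (i := i) (j := n - i) (by omega)]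
  unfold nestedBr
  rw [epsBr_snd, Fin.sum_univ_succ]
  congr 1
  · have e : ∀ y : L × L, (fun b : Fin (n - (i : ℕ) + 1) => L.epsSlot 0 b
        ((Fin.cons y (fun b : Fin (n - (i : ℕ)) => z ⟨i + b, by omega⟩) :
          Fin (n - (i : ℕ) + 1) → L × L) b))
        = Function.update (Fin.cons 0 fun b : Fin (n - (i : ℕ)) => L.sgn (z ⟨i + b, by omega⟩).1)
          0 y.2 := by
      intro y
      ext b
      refine Fin.cases ?_ (fun b => ?_) b
      · simp
      · simp [epsSlot_of_gt (Fin.succ_pos b)]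
    rw [e, epsBr_snd, MultilinearMap.map_update_sum]
    refine Finset.sum_congr rfl fun a _ => ?_
    congr 1
    ext b
    refine Fin.cases ?_ (fun b => ?_) b
    · simp only [Function.update_self, Fin.cons_zero]
      congr 1
      ext c
      simp [epsSlot, ← Fin.ext_iff]
    · simp only [Function.update_of_ne (Fin.succ_ne_zero b), Fin.cons_succ]
      rw [epsSlot_of_gt]
      rw [Fin.lt_def]
      simp only
      omega
  · refine Finset.sum_congr rfl fun a _ => ?_
    congr 1
    ext b
    refine Fin.cases ?_ (fun b => ?_) b
    · simp only [Fin.cons_zero]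
      rw [epsSlot_of_lt (Fin.succ_pos a), epsBr_fst]
      congr 1
      ext c
      rw [epsSlot_of_lt]
      rw [Fin.lt_def]
      simp only
      omega
    · simp [epsSlot, ← Fin.ext_iff]

/-- The brackets of `L ⊗ k[ε]` satisfy the higher Jacobi identities. -/
lemma jacobiator_epsBr (n : ℕ) (d : Fin n → ℕ) (z : Fin n → L × L)
    (h1 : ∀ b, (z b).1 ∈ L.deg (d b)) (h2 : ∀ b, (z b).2 ∈ L.deg (d b + 1)) :
    jacobiator L.epsBr n d z = 0 := by
  refine Prod.ext ?_ ?_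
  · rw [Prod.fst_zero, ← jacobiator_br n d _ h1]
    simp only [jacobiator, Prod.fst_sum, Prod.smul_fst, nestedBr_epsBr_fst]
    rfl
  · have key : ∀ (i : Fin (n + 1)) (σ : Equiv.Perm (Fin n)),
        koszulSign σ d • (nestedBr L.epsBr n i (z ∘ σ)).2
          = ∑ m, KoszulSign.tailSign m 1 d •
            koszulSign σ (Function.update d m (d m + 1)) •
              nestedBr L.br n i (epsTuple z m ∘ σ) := by
      intro i σ
      rw [nestedBr_epsBr_snd, Finset.smul_sum]
      conv_rhs => rw [← Equiv.sum_comp σ]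
      refine Finset.sum_congr rfl fun q _ => ?_
      have := epsSlot_perm σ h1 q
      simp only [Function.comp_apply] at this ⊢
      rw [this]
      erw [nestedBr_zsmul]
      rw [← KoszulSign.tailSign_eq (σ q) σ d q rfl, smul_smul, smul_smul,
        KoszulSign.koszulSign_mul_tailSign, mul_comm]
      rfl
    have : (jacobiator L.epsBr n d z).2 = ∑ m, KoszulSign.tailSign m 1 d •
        jacobiator L.br n (Function.update d m (d m + 1)) (epsTuple z m) := by
      simp only [jacobiator, Prod.snd_sum, Prod.smul_snd, key, Finset.smul_sum]
      conv_rhs => rw [Finset.sum_comm]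
      refine Finset.sum_congr rfl fun i _ => ?_
      rw [Finset.sum_comm]
      refine Finset.sum_congr rfl fun m _ => Finset.sum_congr rfl fun σ _ => ?_
      rw [smul_comm]
    rw [this]
    refine Finset.sum_eq_zero fun m _ => ?_
    rw [jacobiator_br _ _ _ (epsTuple_mem h1 h2 m), smul_zero]

/-- Graded antisymmetry in `L ⊗ k[ε]`. -/
lemma epsBr_perm (n : ℕ) (σ : Equiv.Perm (Fin n)) (d : Fin n → ℕ) (z : Fin n → L × L)
    (h1 : ∀ b, (z b).1 ∈ L.deg (d b)) (h2 : ∀ b, (z b).2 ∈ L.deg (d b + 1)) :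
    L.epsBr n (z ∘ σ) = koszulSign σ d • L.epsBr n z := by
  refine Prod.ext ?_ ?_
  · exact br_perm n σ d _ h1
  · have key : ∀ σ : Equiv.Perm (Fin n), (L.epsBr n (z ∘ σ)).2 = ∑ m, KoszulSign.tailSign m σ d •
        L.br n (epsTuple z m ∘ σ) := by
      intro σ
      rw [epsBr_snd]
      conv_rhs => rw [← Equiv.sum_comp σ]
      refine Finset.sum_congr rfl fun q _ => ?_
      have := epsSlot_perm σ h1 q
      simp only [Function.comp_apply] at this ⊢
      rw [this, map_zsmul_univ, ← KoszulSign.tailSign_eq (σ q) σ d q rfl]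
      rfl
    have k1 := key 1
    rw [Equiv.Perm.coe_one, Function.comp_id] at k1
    rw [key, Prod.smul_snd, k1, Finset.smul_sum]
    refine Finset.sum_congr rfl fun m _ => ?_
    rw [br_perm n σ _ _ (epsTuple_mem h1 h2 m), Function.comp_id, smul_smul, smul_smul]
    congr 1
    have e1 := KoszulSign.koszulSign_mul_tailSign m σ d
    have e2 := KoszulSign.koszulSign_mul_self σ d
    have e3 := KoszulSign.koszulSign_mul_self σ (Function.update d m (d m + 1))
    linear_combination (koszulSign σ d * koszulSign σ (Function.update d m (d m + 1))) * e1
      - KoszulSign.tailSign m σ d * koszulSign σ (Function.update d m (d m + 1)) * e2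
      + koszulSign σ d * KoszulSign.tailSign m 1 d * e3

lemma epsSlot_mem {n : ℕ} {d : Fin n → ℕ} {z : Fin n → L × L}
    (h1 : ∀ b, (z b).1 ∈ L.deg (d b)) (h2 : ∀ b, (z b).2 ∈ L.deg (d b + 1)) (q b : Fin n) :
    L.epsSlot q b (z b) ∈ L.deg (Function.update d q (d q + 1) b) := by
  rcases lt_trichotomy b q with h | rfl | h
  · rw [epsSlot_of_lt h, Function.update_of_ne h.ne]; exact h1 b
  · simpa using h2 b
  · rw [epsSlot_of_gt h, Function.update_of_ne h.ne']; exact sgn_mem (h1 b)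

lemma sum_update_add_one {n : ℕ} (d : Fin n → ℕ) (q : Fin n) :
    ∑ b, Function.update d q (d q + 1) b = (∑ b, d b) + 1 := by
  rw [Finset.sum_update_of_mem (Finset.mem_univ q), ← Finset.add_sum_erase _ d
    (Finset.mem_univ q), Finset.sdiff_singleton_eq_erase]
  omega

lemma epsBr_snd_mem (n : ℕ) (d : Fin n → ℕ) (z : Fin n → L × L)
    (h1 : ∀ b, (z b).1 ∈ L.deg (d b)) (h2 : ∀ b, (z b).2 ∈ L.deg (d b + 1)) (m : ℕ)
    (hm : (∑ b, d b) + n + 1 = m + 2) : (L.epsBr n z).2 ∈ L.deg m := by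
  rw [epsBr_snd]
  refine sum_mem fun q _ => L.br_mem n _ _ (epsSlot_mem h1 h2 q) m ?_
  rw [sum_update_add_one]
  omega

lemma Hom.map_epsBr (f : Hom L L') (n : ℕ) (z : Fin n → L × L) :
    L'.epsBr n (fun b => (f.toLin (z b).1, f.toLin (z b).2))
      = (f.toLin (L.epsBr n z).1, f.toLin (L.epsBr n z).2) := by
  refine Prod.ext ?_ ?_
  · simp [f.map_br]
  · rw [epsBr_snd, epsBr_snd, map_sum]
    refine Finset.sum_congr rfl fun q _ => ?_
    rw [f.map_br]
    congr 1
    ext b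
    rcases lt_trichotomy b q with h | rfl | h
    · simp [epsSlot_of_lt h]
    · simp
    · simp [epsSlot_of_gt h, f.map_sgn]

lemma epsBr_one (z : L × L) : L.epsBr 1 (fun _ => z) = (L.diff z.1, L.diff z.2) := by
  have e : ∀ x : L, (fun _ : Fin 1 => x) = ![x] := fun x => by ext i; fin_cases i; rfl
  refine Prod.ext ?_ ?_
  · rw [epsBr_fst, e]; rfl
  · rw [epsBr_snd, Fin.sum_univ_one]
    have : (fun b => L.epsSlot (0 : Fin 1) b z) = ![z.2] := by
      ext i; fin_cases i; simp
    rw [this]; rfl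

end LInfAlgebroid

namespace LInfAlgebroid

variable {k : Type} {A : Type u} [Field k] [CharZero k] [CommRing A] [Algebra k A]
variable (L L' : LInfAlgebroid.{0, u, v} k A)

/-- The `L`-valued polynomial differential forms `x(t) + y(t) dt` on the line, as pairs of polynomial
functions. -/
abbrev Forms : Type v := PolyFun k A (L × L)

/-- The part `x(t) + y(t) dt ↦ ± x'(t) dt` of the differential. -/
def formsDer : L.Forms →ₗ[A] L.Forms :=
  PolyFun.map (LinearMap.inr A L L ∘ₗ L.sgn ∘ₗ LinearMap.fst A L L) ∘ₗ PolyFun.der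

/-- The part of the brackets of forms that involves derivatives. -/
def formsDerBr : (n : ℕ) → MultilinearMap k (fun _ : Fin n => L.Forms) L.Forms
  | 1 => MultilinearMap.ofSubsingleton k L.Forms L.Forms (0 : Fin 1)
      (L.formsDer.restrictScalars k)
  | _ => 0

/-- The brackets of forms. -/
def formsBr (n : ℕ) : MultilinearMap k (fun _ : Fin n => L.Forms) L.Forms :=
  PolyFun.mapMul (L.epsBr n) + L.formsDerBr n

/-- The differential of forms. -/
def formsDiff : L.Forms →ₗ[A] L.Forms :=
  PolyFun.map (LinearMap.prodMap L.diff L.diff) + L.formsDer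

/-- The forms of degree `d`, for `d` non-negative. -/
def formsDeg (d : ℕ) : Submodule A L.Forms where
  carrier := {f | ∀ t, (f.1 t).1 ∈ L.deg d ∧ (f.1 t).2 ∈ L.deg (d + 1)}
  zero_mem' _ := ⟨zero_mem _, zero_mem _⟩
  add_mem' hf hg t := ⟨add_mem (hf t).1 (hg t).1, add_mem (hf t).2 (hg t).2⟩
  smul_mem' a _ hf t := ⟨Submodule.smul_mem _ a (hf t).1, Submodule.smul_mem _ a (hf t).2⟩

variable {L L'}

lemma formsDer_apply (f : L.Forms) (t : k) :
    (L.formsDer f).1 t = (0, L.sgn ((PolyFun.der f).1 t).1) := rfl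

lemma formsDiff_apply (f : L.Forms) (t : k) :
    (L.formsDiff f).1 t
      = (L.diff (f.1 t).1, L.diff (f.1 t).2 + L.sgn ((PolyFun.der f).1 t).1) := by
  have : (L.formsDiff f).1 t = (L.diff (f.1 t).1, L.diff (f.1 t).2)
    + (0, L.sgn ((PolyFun.der f).1 t).1) := rfl
  rw [this]; simp

lemma formsDerBr_of_ne {n : ℕ} (h : n ≠ 1) (f : Fin n → L.Forms) : L.formsDerBr n f = 0 := by
  match n, h with
  | 0, _ => rfl
  | n + 2, _ => rfl

lemma formsDerBr_of_eq {n : ℕ} (h : n = 1) (j : Fin n) (f : Fin n → L.Forms) :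
    L.formsDerBr n f = L.formsDer (f j) := by
  subst h
  rw [Subsingleton.elim j 0]
  rfl

lemma formsBr_of_ne {n : ℕ} (h : n ≠ 1) (f : Fin n → L.Forms) :
    L.formsBr n f = PolyFun.mapMul (L.epsBr n) f := by
  simp [formsBr, formsDerBr_of_ne h]

lemma formsBr_one (f : Fin 1 → L.Forms) : L.formsBr 1 f = L.formsDiff (f 0) := by
  have e : f = fun _ => f 0 := by ext1 i; rw [Subsingleton.elim i 0]
  refine PolyFun.ext fun t => ?_
  have : (L.formsBr 1 f).1 t = L.epsBr 1 (fun i => (f i).1 t) + (L.formsDer (f 0)).1 t := rfl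
  rw [this, e, epsBr_one]
  rfl

omit [CharZero k] in
lemma epsBr_zero (z : Fin 0 → L × L) : L.epsBr 0 z = 0 := by
  refine Prod.ext (br_zero_eq _) ?_
  simp [epsBr_snd]

lemma formsBr_zero (f : Fin 0 → L.Forms) : L.formsBr 0 f = 0 := by
  rw [formsBr_of_ne (by simp)]
  exact PolyFun.ext fun t => epsBr_zero _

/-- The derivative commutes with linear maps. -/
lemma der_map_apply {V W : Type*} [AddCommGroup V] [Module k V] [Module A V] [IsScalarTower k A V]
    [AddCommGroup W] [Module k W] [Module A W] [IsScalarTower k A W]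
    (g : V →ₗ[A] W) (f : PolyFun k A V) (t : k) :
    (PolyFun.der (PolyFun.map g f)).1 t = g ((PolyFun.der f).1 t) := by
  rw [PolyFun.der_map]; rfl

lemma der_mem_deg {d : ℕ} {f : L.Forms} (hf : ∀ t, (f.1 t).1 ∈ L.deg d) (t : k) :
    ((PolyFun.der f).1 t).1 ∈ L.deg d := by
  have h : PolyFun.map (L.proj d ∘ₗ LinearMap.fst A L L) f
      = PolyFun.map (LinearMap.fst A L L) f :=
    PolyFun.ext fun t => proj_of_mem (hf t)
  have h1 := der_map_apply (L.proj d ∘ₗ LinearMap.fst A L L) f t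
  rw [h, der_map_apply] at h1
  have h2 : ((PolyFun.der f).1 t).1 = L.proj d ((PolyFun.der f).1 t).1 := h1
  rw [h2]
  exact proj_mem _ _

lemma formsDer_formsDer (f : L.Forms) : L.formsDer (L.formsDer f) = 0 := by
  refine PolyFun.ext fun t => ?_
  rw [formsDer_apply]
  have h := der_map_apply (LinearMap.fst A L L) (L.formsDer f) t
  have h0 : PolyFun.map (LinearMap.fst A L L) (L.formsDer f) = 0 := PolyFun.ext fun t => rfl
  rw [h0, map_zero] at h
  have h' : ((PolyFun.der (L.formsDer f)).1 t).1 = 0 := h.symm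
  rw [h', map_zero]
  rfl

lemma formsDer_formsDerBr {n : ℕ} (f : Fin n → L.Forms) :
    L.formsDer (L.formsDerBr n f) = 0 := by
  by_cases h : n = 1
  · rw [formsDerBr_of_eq h ⟨0, by omega⟩, formsDer_formsDer]
  · rw [formsDerBr_of_ne h, map_zero]

lemma formsBr_mem (n : ℕ) (d : Fin n → ℕ) (f : Fin n → L.Forms) (hf : ∀ b, f b ∈ L.formsDeg (d b))
    (m : ℕ) (hm : (∑ b, d b) + n = m + 2) : L.formsBr n f ∈ L.formsDeg m := by
  intro t
  have h1 : (L.epsBr n fun b => (f b).1 t).1 ∈ L.deg m :=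
    L.br_mem n d _ (fun b => (hf b t).1) m hm
  have h2 : (L.epsBr n fun b => (f b).1 t).2 ∈ L.deg (m + 1) :=
    epsBr_snd_mem n d _ (fun b => (hf b t).1) (fun b => (hf b t).2) (m + 1) (by omega)
  by_cases hn : n = 1
  · subst hn
    have : (L.formsBr 1 f).1 t = L.epsBr 1 (fun i => (f i).1 t) + (L.formsDer (f 0)).1 t := rfl
    rw [this, formsDer_apply]
    refine ⟨by simpa using h1, add_mem h2 (sgn_mem ?_)⟩
    have e : d 0 = m + 1 := by simpa using hm
    rw [← e]
    exact der_mem_deg (fun t => (hf 0 t).1) t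
  · rw [formsBr_of_ne hn]
    exact ⟨h1, h2⟩

/-- In the Jacobi identity, the terms with a derivative outside. -/
lemma outer_formsDer (n : ℕ) (i : Fin (n + 1)) (f : Fin n → L.Forms) :
    L.formsDerBr (n - (i : ℕ) + 1) (Fin.cons (L.formsBr i fun a : Fin (i : ℕ) => f ⟨a, by omega⟩)
      fun b : Fin (n - (i : ℕ)) => f ⟨(i : ℕ) + b, by omega⟩)
      = if (i : ℕ) = n then L.formsDer (PolyFun.mapMul (L.epsBr n) f) else 0 := by
  split_ifs with h
  · rw [formsDerBr_of_eq (by omega) 0, Fin.cons_zero]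
    obtain ⟨i, hi⟩ := i
    simp only at h
    subst h
    rw [formsBr, add_apply, map_add, formsDer_formsDerBr, add_zero]
  · exact formsDerBr_of_ne (by omega) _

lemma nestedBr_formsBr (n : ℕ) (i : Fin (n + 1)) (f : Fin n → L.Forms) :
    nestedBr L.formsBr n i f
      = nestedBr (fun n => PolyFun.mapMul (L.epsBr n)) n i f
        + PolyFun.mapMul (L.epsBr (n - (i : ℕ) + 1))
          (Fin.cons (L.formsDerBr i fun a : Fin (i : ℕ) => f ⟨a, by omega⟩)
            fun b : Fin (n - (i : ℕ)) => f ⟨(i : ℕ) + b, by omega⟩)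
        + if (i : ℕ) = n then L.formsDer (PolyFun.mapMul (L.epsBr n) f) else 0 := by
  rw [← outer_formsDer]
  unfold nestedBr
  conv_lhs => rw [formsBr, add_apply]
  congr 1
  conv_lhs => rw [formsBr, add_apply]
  exact MultilinearMap.cons_add _ _ _ _

omit [CharZero k] in
lemma jacobiator_mapMul_epsBr (n : ℕ) (d : Fin n → ℕ) (f : Fin n → L.Forms)
    (hf : ∀ b, f b ∈ L.formsDeg (d b)) :
    jacobiator (fun n => PolyFun.mapMul (L.epsBr n)) n d f = 0 := by
  refine PolyFun.ext fun t => ?_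
  refine (map_jacobiator (β' := L.epsBr) (fun n => PolyFun.mapMul (L.epsBr n))
    (PolyFun.eval t : L.Forms →ₗ[A] L × L).toAddMonoidHom (fun n x => rfl) n d f).trans ?_
  exact jacobiator_epsBr n d _ (fun b => (hf b t).1) (fun b => (hf b t).2)

/-- The tuple of values of the first components, with the value of the derivative at one slot. -/
def derTuple {n : ℕ} (f : Fin n → L.Forms) (t : k) (m : Fin n) : Fin n → L :=
  Function.update (fun b => ((f b).1 t).1) m ((PolyFun.der (f m)).1 t).1

lemma derTuple_mem {n : ℕ} {d : Fin n → ℕ} {f : Fin n → L.Forms}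
    (hf : ∀ b, f b ∈ L.formsDeg (d b)) (t : k) (m b : Fin n) :
    derTuple f t m b ∈ L.deg (d b) := by
  unfold derTuple
  by_cases h : b = m
  · subst h
    simpa using der_mem_deg (fun t => (hf b t).1) t
  · simpa [h] using (hf b t).1

/-- The derivative of the bracket. -/
lemma formsDer_mapMul (n : ℕ) (f : Fin n → L.Forms) (t : k) :
    (L.formsDer (PolyFun.mapMul (L.epsBr n) f)).1 t
      = (0, L.sgn (∑ m, L.br n (derTuple f t m))) := by
  rw [formsDer_apply]
  congr 2
  have h := der_map_apply (LinearMap.fst A L L) (PolyFun.mapMul (L.epsBr n) f) t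
  refine h.symm.trans ?_
  have e : PolyFun.map (LinearMap.fst A L L) (PolyFun.mapMul (L.epsBr n) f)
      = PolyFun.mapMul (L.br n) fun b => PolyFun.map (LinearMap.fst A L L) (f b) := rfl
  rw [e, PolyFun.der_mapMul]
  rw [Submodule.coe_sum, Finset.sum_apply]
  refine Finset.sum_congr rfl fun m _ => ?_
  rw [PolyFun.mapMul_apply]
  congr 1
  ext b
  unfold derTuple
  by_cases h : b = m
  · subst h
    simp only [Function.update_self]
    exact der_map_apply _ _ _
  · simp [h]

omit [CharZero k] in
lemma br_sgn_comp_perm {n : ℕ} (σ : Equiv.Perm (Fin n)) {d : Fin n → ℕ} {x : Fin n → L}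
    (hx : ∀ b, x b ∈ L.deg (d b)) :
    koszulSign σ d • L.br n (fun b => L.sgn (x (σ b))) = (-1 : ℤ) ^ (∑ b, d b) • L.br n x := by
  have e : (fun b => L.sgn (x b)) = fun b => (-1 : ℤ) ^ d b • x b :=
    funext fun b => sgn_of_mem (hx b)
  have h := br_perm n σ d (fun b => L.sgn (x b)) fun b => sgn_mem (hx b)
  have h' : L.br n (fun b => L.sgn (x (σ b))) = koszulSign σ d • L.br n fun b => L.sgn (x b) := h
  rw [h', smul_smul, KoszulSign.koszulSign_mul_self, one_smul, e, map_zsmul_univ,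
    Finset.prod_pow_eq_pow_sum]

/-- In the Jacobi identity, the terms with a derivative inside. -/
lemma inner_formsDer (n : ℕ) (f : Fin (n + 1) → L.Forms) (t : k) (y : L.Forms) :
    (PolyFun.mapMul (L.epsBr (n + 1)) (Fin.cons (L.formsDer y) fun b => f b.succ)).1 t
      = (0, L.br (n + 1) fun b => L.sgn
          ((Fin.cons ((PolyFun.der y).1 t).1 fun b => ((f b.succ).1 t).1 : Fin (n + 1) → L) b)) := by
  rw [PolyFun.mapMul_apply]
  refine Prod.ext ?_ ?_
  · rw [epsBr_fst]
    exact (L.br (n + 1)).map_coord_zero 0 rfl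
  · rw [epsBr_snd, Finset.sum_eq_single 0]
    · congr 1
      ext b
      refine Fin.cases ?_ (fun b => ?_) b
      · rw [epsSlot_self]; rfl
      · rw [epsSlot_of_gt (Fin.succ_pos b)]; rfl
    · intro q _ hq
      refine (L.br (n + 1)).map_coord_zero 0 ?_
      rw [epsSlot_of_lt (Fin.pos_of_ne_zero hq)]
      rfl
    · simp

/-- The terms with derivatives cancel in the Jacobi identity. -/
lemma sum_inner_formsDer (n : ℕ) (d : Fin n → ℕ) (f : Fin n → L.Forms)
    (hf : ∀ b, f b ∈ L.formsDeg (d b)) :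
    ∑ i : Fin (n + 1), (-1 : ℤ) ^ ((i : ℕ) * (n - (i : ℕ))) •
      ∑ σ : Equiv.Perm (Fin n) with IsUnshuffle i σ, koszulSign σ d •
        PolyFun.mapMul (L.epsBr (n - (i : ℕ) + 1))
          (Fin.cons (L.formsDerBr i fun a : Fin (i : ℕ) => (f ∘ σ) ⟨a, by omega⟩)
            fun b : Fin (n - (i : ℕ)) => (f ∘ σ) ⟨(i : ℕ) + b, by omega⟩)
      = - L.formsDer (PolyFun.mapMul (L.epsBr n) f) := by
  have hz : ∀ i : Fin (n + 1), (i : ℕ) ≠ 1 → (-1 : ℤ) ^ ((i : ℕ) * (n - (i : ℕ))) •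
      ∑ σ : Equiv.Perm (Fin n) with IsUnshuffle i σ, koszulSign σ d •
        PolyFun.mapMul (L.epsBr (n - (i : ℕ) + 1))
          (Fin.cons (L.formsDerBr i fun a : Fin (i : ℕ) => (f ∘ σ) ⟨a, by omega⟩)
            fun b : Fin (n - (i : ℕ)) => (f ∘ σ) ⟨(i : ℕ) + b, by omega⟩) = 0 := by
    intro i hi
    rw [Finset.sum_eq_zero, smul_zero]
    intro σ _
    rw [MultilinearMap.map_coord_zero _ 0 (by rw [Fin.cons_zero, formsDerBr_of_ne hi]), smul_zero]
  cases n with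
  | zero =>
    rw [Finset.sum_eq_zero fun i _ => hz i (by omega)]
    refine PolyFun.ext fun t => ?_
    have := formsDer_mapMul 0 f t
    simp only [Finset.univ_eq_empty, Finset.sum_empty, map_zero] at this
    rw [Submodule.coe_neg, Pi.neg_apply, this]
    exact neg_zero.symm
  | succ n =>
    rw [Finset.sum_eq_single (⟨1, by omega⟩ : Fin (n + 1 + 1))
      (fun i _ hi => hz i fun e => hi (Fin.ext e)) (by simp)]
    refine PolyFun.ext fun t => ?_
    have key : ∀ σ : Equiv.Perm (Fin (n + 1)), (koszulSign σ d •
        PolyFun.mapMul (L.epsBr (n + 1 - 1 + 1))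
          (Fin.cons (L.formsDerBr 1 fun a : Fin 1 => (f ∘ σ) ⟨a, by omega⟩)
            fun b : Fin (n + 1 - 1) => (f ∘ σ) ⟨1 + b, by omega⟩)).1 t
        = (0, (-1 : ℤ) ^ (∑ b, d b) • L.br (n + 1) (derTuple f t (σ 0))) := by
      intro σ
      have h1 := inner_formsDer n (fun b => f (σ b)) t (f (σ 0))
      have h2 : PolyFun.mapMul (L.epsBr (n + 1 - 1 + 1))
          (Fin.cons (L.formsDerBr 1 fun a : Fin 1 => (f ∘ σ) ⟨a, by omega⟩)
            fun b : Fin (n + 1 - 1) => (f ∘ σ) ⟨1 + b, by omega⟩)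
          = PolyFun.mapMul (L.epsBr (n + 1))
            (Fin.cons (L.formsDer (f (σ 0))) fun b : Fin n => f (σ b.succ)) := by
        have e : ∀ b : Fin n, (⟨1 + b, by omega⟩ : Fin (n + 1)) = b.succ := fun b =>
          Fin.ext (add_comm _ _)
        simp only [Function.comp_apply]
        congr 1
        refine congrArg₂ _ ?_ (funext fun b => ?_)
        · rw [formsDerBr_of_eq rfl 0]; rfl
        · exact congrArg (fun c => f (σ c)) (e b)
      rw [h2]
      have h3 : ∀ (c : ℤ) (g : L.Forms), (c • g).1 t = c • g.1 t := fun c g => rfl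
      rw [h3, h1, ← br_sgn_comp_perm σ (derTuple_mem hf t (σ 0))]
      refine Prod.ext (by simp) ?_
      show koszulSign σ d • L.br (n + 1) _ = koszulSign σ d • L.br (n + 1) _
      congr 2
      ext b
      congr 1
      unfold derTuple
      refine Fin.cases ?_ (fun b => ?_) b
      · simp
      · simp [Function.update_of_ne, σ.injective.ne (Fin.succ_ne_zero b)]
    have h3 : ∀ (c : ℤ) (g : L.Forms), (c • g).1 t = c • g.1 t := fun c g => rfl
    rw [h3, Submodule.coe_sum, Finset.sum_apply, Finset.sum_congr rfl fun σ _ => key σ,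
      sum_isUnshuffle_one fun m => ((0 : L), (-1 : ℤ) ^ (∑ b, d b) • L.br (n + 1) (derTuple f t m)),
      Submodule.coe_neg, Pi.neg_apply, formsDer_mapMul]
    refine Prod.ext (by simp [Prod.fst_sum]) ?_
    simp only [Prod.smul_snd, Prod.snd_sum, Prod.snd_neg, map_sum, ← Finset.sum_neg_distrib,
      Finset.smul_sum]
    refine Finset.sum_congr rfl fun m _ => ?_
    by_cases hd : (∑ b, d b) + (n + 1) < 2
    · rw [L.br_eq_zero (n + 1) d _ (derTuple_mem hf t m) hd]
      simp
    · obtain ⟨e, he⟩ : ∃ e, (∑ b, d b) + (n + 1) = e + 2 := ⟨(∑ b, d b) + (n + 1) - 2, by omega⟩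
      rw [sgn_of_mem (L.br_mem (n + 1) d _ (derTuple_mem hf t m) e he), smul_smul, ← neg_smul]
      congr 1
      have hp : (-1 : ℤ) ^ ((∑ b, d b) + (n + 1)) = (-1) ^ (e + 2) := by rw [he]
      rw [pow_add, pow_succ, pow_add] at hp
      simp only [one_mul, Nat.add_sub_cancel]
      linear_combination - hp

/-- The brackets of forms satisfy the higher Jacobi identities. -/
lemma jacobiator_formsBr (n : ℕ) (d : Fin n → ℕ) (f : Fin n → L.Forms)
    (hf : ∀ b, f b ∈ L.formsDeg (d b)) : jacobiator L.formsBr n d f = 0 := by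
  have h1 := jacobiator_mapMul_epsBr n d f hf
  have h2 := sum_inner_formsDer n d f hf
  have h3 : ∑ i : Fin (n + 1), (-1 : ℤ) ^ ((i : ℕ) * (n - (i : ℕ))) •
      ∑ σ : Equiv.Perm (Fin n) with IsUnshuffle i σ, koszulSign σ d •
        (if (i : ℕ) = n then L.formsDer (PolyFun.mapMul (L.epsBr n) (f ∘ σ)) else 0)
      = L.formsDer (PolyFun.mapMul (L.epsBr n) f) := by
    rw [Finset.sum_eq_single (Fin.last n)]
    · simp only [Fin.val_last, if_true]
      rw [sum_isUnshuffle_self (fun σ : Equiv.Perm (Fin n) => koszulSign σ d •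
        L.formsDer (PolyFun.mapMul (L.epsBr n) (f ∘ σ)))]
      simp
    · intro i _ hi
      have : (i : ℕ) ≠ n := fun e => hi (Fin.ext e)
      simp [this]
    · simp
  unfold jacobiator at h1 ⊢
  simp only [nestedBr_formsBr, smul_add, Finset.sum_add_distrib]
  rw [h1, h2, h3]
  simp

end LInfAlgebroid

namespace LInfAlgebroid

variable {k : Type} {A : Type u} [Field k] [CharZero k] [CommRing A] [Algebra k A]
variable (L L' : LInfAlgebroid.{0, u, v} k A)

/-- The component of degree `-1` of a form. -/
def formsNeg : L.Forms →ₗ[A] PolyFun k A L :=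
  PolyFun.map (L.proj 0 ∘ₗ LinearMap.snd A L L)

/-- The good truncation of the forms in degrees `≥ 0`. -/
def pathModule : Submodule A L.Forms :=
  LinearMap.ker L.formsNeg ⊓ LinearMap.ker (L.formsNeg ∘ₗ L.formsDiff)

/-- The projection of forms to degree `n`, for `n` non-negative. -/
def formsProj (n : ℕ) : L.Forms →ₗ[A] L.Forms :=
  PolyFun.map (LinearMap.prodMap (L.proj n) (L.proj (n + 1)))

variable {L L'}

lemma mem_pathModule {f : L.Forms} : f ∈ L.pathModule ↔
    (∀ t, L.proj 0 (f.1 t).2 = 0) ∧ ∀ t, L.proj 0 ((L.formsDiff f).1 t).2 = 0 := by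
  constructor
  · rintro ⟨h1, h2⟩
    exact ⟨fun t => congrFun (congrArg Subtype.val h1) t,
      fun t => congrFun (congrArg Subtype.val h2) t⟩
  · rintro ⟨h1, h2⟩
    exact ⟨PolyFun.ext h1, PolyFun.ext h2⟩

omit [CharZero k] in
lemma formsProj_apply (n : ℕ) (f : L.Forms) (t : k) :
    (L.formsProj n f).1 t = (L.proj n (f.1 t).1, L.proj (n + 1) (f.1 t).2) := rfl

lemma formsDiff_formsProj_snd (n : ℕ) (f : L.Forms) (t : k) :
    ((L.formsDiff (L.formsProj n f)).1 t).2 = L.proj n ((L.formsDiff f).1 t).2 := by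
  have h := der_map_apply (LinearMap.prodMap (L.proj n) (L.proj (n + 1))) f t
  have h' : ((PolyFun.der (L.formsProj n f)).1 t).1 = L.proj n ((PolyFun.der f).1 t).1 :=
    congrArg Prod.fst h
  simp only [formsDiff_apply, formsProj_apply, map_add, h', diff_proj, proj_sgn]

lemma formsProj_mem {f : L.Forms} (hf : f ∈ L.pathModule) (n : ℕ) :
    L.formsProj n f ∈ L.pathModule := by
  rw [mem_pathModule] at hf ⊢
  refine ⟨fun t => proj_proj_of_ne (Nat.succ_ne_zero n) _, fun t => ?_⟩
  rw [formsDiff_formsProj_snd]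
  by_cases h : n = 0
  · subst h; rw [hf.2 t, map_zero]
  · exact proj_proj_of_ne h _

omit [CharZero k] in
lemma sum_formsProj (f : L.Forms) : ∃ N₀, ∀ N, N₀ ≤ N →
    f = PolyFun.map (LinearMap.inr A L L ∘ₗ L.proj 0 ∘ₗ LinearMap.snd A L L) f
      + ∑ n ∈ Finset.range N, L.formsProj n f := by
  induction f using PolyFun.induction with
  | h0 => exact ⟨0, by simp⟩
  | hadd f g hf hg =>
    obtain ⟨N, hN⟩ := hf
    obtain ⟨N', hN'⟩ := hg
    refine ⟨max N N', fun M hM => ?_⟩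
    simp only [map_add, Finset.sum_add_distrib]
    nth_rw 1 [hN M (le_of_max_le_left hM), hN' M (le_of_max_le_right hM)]
    abel
  | hmono i z =>
    obtain ⟨N, hN⟩ := sum_proj z.1
    obtain ⟨N', hN'⟩ := sum_proj z.2
    refine ⟨max N N', fun M hM => ?_⟩
    simp only [formsProj, PolyFun.map_mono]
    rw [← map_sum, ← map_add]
    congr 1
    refine Prod.ext ?_ ?_
    · simpa [Prod.fst_sum] using hN M (le_of_max_le_left hM)
    · have := hN' (M + 1) (by omega)
      rw [Finset.sum_range_succ'] at this
      simpa [Prod.snd_sum, add_comm] using this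

lemma sum_formsProj_of_mem {f : L.Forms} (hf : f ∈ L.pathModule) :
    ∃ N, f = ∑ n ∈ Finset.range N, L.formsProj n f := by
  obtain ⟨N, hN⟩ := sum_formsProj f
  refine ⟨N, ?_⟩
  have h := hN N le_rfl
  have h0 : PolyFun.map (LinearMap.inr A L L ∘ₗ L.proj 0 ∘ₗ LinearMap.snd A L L) f = 0 := by
    refine PolyFun.ext fun t => ?_
    show ((0 : L), L.proj 0 (f.1 t).2) = 0
    rw [(mem_pathModule.1 hf).1 t]
    rfl
  rwa [h0, zero_add] at h

omit [CharZero k] in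
lemma formsProj_mem_deg (n : ℕ) (f : L.Forms) : L.formsProj n f ∈ L.formsDeg n :=
  fun _ => ⟨proj_mem _ _, proj_mem _ _⟩

lemma mem_pathModule_of_mem_deg {d : ℕ} {f : L.Forms} (hf : f ∈ L.formsDeg d) (hd : 0 < d) :
    f ∈ L.pathModule := by
  rw [mem_pathModule]
  refine ⟨fun t => proj_of_mem_of_ne (Nat.succ_ne_zero d) (hf t).2, fun t => ?_⟩
  refine proj_of_mem_of_ne hd.ne' ?_
  rw [formsDiff_apply]
  exact add_mem (diff_mem (hf t).2) (sgn_mem (der_mem_deg (fun t => (hf t).1) t))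

lemma mem_pathModule_iff_of_mem_deg_zero {f : L.Forms} (hf : f ∈ L.formsDeg 0) :
    f ∈ L.pathModule ↔ L.formsDiff f = 0 := by
  rw [mem_pathModule]
  constructor
  · rintro ⟨-, h⟩
    refine PolyFun.ext fun t => Prod.ext ?_ ?_
    · rw [formsDiff_apply]; exact diff_of_mem_zero (hf t).1
    · have h2 : ((L.formsDiff f).1 t).2 ∈ L.deg 0 := by
        rw [formsDiff_apply]
        exact add_mem (diff_mem (hf t).2) (sgn_mem (der_mem_deg (fun t => (hf t).1) t))
      rw [← proj_of_mem h2, h t]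
      rfl
  · intro h
    refine ⟨fun t => proj_of_mem_of_ne (Nat.succ_ne_zero 0) (hf t).2, fun t => ?_⟩
    rw [h]
    exact map_zero _

omit [CharZero k] in
lemma diff_diff (x : L) : L.diff (L.diff x) = 0 := by
  have : L.diff ∘ₗ L.diff = 0 := linearMap_ext fun n x hx => by
    have h := jacobiator_br 1 (fun _ => n) (fun _ => x) fun _ => hx
    unfold jacobiator at h
    rw [Finset.sum_eq_single (Fin.last 1)] at h
    · simp only [Fin.val_last] at h
      rw [sum_isUnshuffle_self (fun σ : Equiv.Perm (Fin 1) => koszulSign σ (fun _ => n) •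
        nestedBr L.br 1 (Fin.last 1) ((fun _ => x) ∘ σ))] at h
      rw [KoszulSign.koszulSign_one, one_smul] at h
      have e : nestedBr L.br 1 (Fin.last 1) ((fun _ => x) ∘ (1 : Equiv.Perm (Fin 1)))
          = L.diff (L.diff x) := by
        unfold nestedBr
        have e1 : ∀ y z : Fin 1 → L, y 0 = z 0 → L.br 1 y = L.br 1 z := fun y z h =>
          congrArg (L.br 1) (funext fun b => by rw [Subsingleton.elim b 0, h])
        exact e1 _ ![L.diff x] (e1 _ ![x] rfl)
      rw [e] at h
      simpa using h
    · intro i _ hi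
      have hi : i = 0 := by
        refine Fin.ext ?_
        have : (i : ℕ) ≠ 1 := fun e => hi (Fin.ext e)
        have := i.2
        simp only [Fin.val_zero]
        omega
      subst hi
      rw [Finset.sum_eq_zero, smul_zero]
      intro σ _
      unfold nestedBr
      rw [MultilinearMap.map_coord_zero _ 0 (br_zero_eq _), smul_zero]
    · simp
  exact LinearMap.congr_fun this x

lemma formsDiff_formsDiff (f : L.Forms) : L.formsDiff (L.formsDiff f) = 0 := by
  refine PolyFun.ext fun t => Prod.ext ?_ ?_
  · simp only [formsDiff_apply, diff_diff]; rfl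
  · have h : ((PolyFun.der (L.formsDiff f)).1 t).1 = L.diff ((PolyFun.der f).1 t).1 := by
      have h1 := der_map_apply (LinearMap.fst A L L) (L.formsDiff f) t
      have h2 := der_map_apply (L.diff ∘ₗ LinearMap.fst A L L) f t
      have e : PolyFun.map (LinearMap.fst A L L) (L.formsDiff f)
          = PolyFun.map (L.diff ∘ₗ LinearMap.fst A L L) f := PolyFun.ext fun t => by
        show ((L.formsDiff f).1 t).1 = _
        rw [formsDiff_apply]
        rfl
      rw [e, h2] at h1
      exact h1.symm
    simp only [formsDiff_apply, map_add, diff_diff, h, diff_sgn]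
    simp

/-- The brackets of homogeneous elements of the truncation are in the truncation. -/
lemma formsBr_mem_pathModule_of_mem_deg (n : ℕ) (d : Fin n → ℕ) (f : Fin n → L.Forms)
    (hf : ∀ b, f b ∈ L.formsDeg (d b)) (hp : ∀ b, f b ∈ L.pathModule) :
    L.formsBr n f ∈ L.pathModule := by
  by_cases h : (∑ b, d b) + n < 2
  · obtain rfl | rfl : n = 0 ∨ n = 1 := by omega
    · rw [formsBr_zero]; exact zero_mem _
    · have h0 : d 0 = 0 := by simp at h; omega
      have h1 := hf 0
      rw [h0] at h1
      rw [formsBr_one, (mem_pathModule_iff_of_mem_deg_zero h1).1 (hp 0)]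
      exact zero_mem _
  · obtain ⟨e, he⟩ : ∃ e, (∑ b, d b) + n = e + 2 := ⟨(∑ b, d b) + n - 2, by omega⟩
    have hm := formsBr_mem n d f hf e he
    rcases Nat.eq_zero_or_pos e with rfl | hpos
    · rw [mem_pathModule_iff_of_mem_deg_zero hm]
      obtain rfl | rfl | rfl : n = 0 ∨ n = 1 ∨ n = 2 := by omega
      · simp at he
      · rw [formsBr_one, formsDiff_formsDiff]
      · have hd : ∀ b, d b = 0 := by
          intro b
          have : ∑ b, d b = 0 := by omega
          exact (Finset.sum_eq_zero_iff.1 this) b (Finset.mem_univ b)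
        have hz : ∀ b, L.formsDiff (f b) = 0 := fun b =>
          (mem_pathModule_iff_of_mem_deg_zero (hd b ▸ hf b)).1 (hp b)
        have h := jacobiator_formsBr 2 d f hf
        unfold jacobiator at h
        rw [Finset.sum_eq_single (Fin.last 2)] at h
        · simp only [Fin.val_last] at h
          rw [sum_isUnshuffle_self (fun σ : Equiv.Perm (Fin 2) => koszulSign σ d •
            nestedBr L.formsBr 2 (Fin.last 2) (f ∘ σ))] at h
          rw [KoszulSign.koszulSign_one, one_smul] at h
          have e : nestedBr L.formsBr 2 (Fin.last 2) (f ∘ (1 : Equiv.Perm (Fin 2)))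
              = L.formsDiff (L.formsBr 2 f) := formsBr_one _
          rw [e] at h
          simpa using h
        · intro i _ hi
          rw [Finset.sum_eq_zero, smul_zero]
          intro σ _
          unfold nestedBr
          rw [MultilinearMap.map_coord_zero _ 0, smul_zero]
          have h2 : (i : ℕ) ≠ 2 := fun e => hi (Fin.ext e)
          obtain ⟨i, hi'⟩ := i
          simp only at h2
          obtain rfl | rfl : i = 0 ∨ i = 1 := by omega
          · exact formsBr_zero _
          · exact (formsBr_one _).trans (hz _)
        · simp
    · exact mem_pathModule_of_mem_deg hm hpos

lemma formsBr_mem_pathModule (n : ℕ) (f : Fin n → L.Forms) (hp : ∀ b, f b ∈ L.pathModule) :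
    L.formsBr n f ∈ L.pathModule := by
  refine (L.formsBr n).mem_of_forall_closure
    (fun _ => {f | f ∈ L.pathModule ∧ ∃ d, f ∈ L.formsDeg d}) L.pathModule.toAddSubgroup ?_ f ?_
  · intro x hx
    choose hx1 d hx2 using hx
    exact formsBr_mem_pathModule_of_mem_deg n d x hx2 hx1
  · intro b
    obtain ⟨N, hN⟩ := sum_formsProj_of_mem (hp b)
    rw [hN]
    exact sum_mem fun n _ =>
      AddSubmonoid.subset_closure ⟨formsProj_mem (hp b) n, n, formsProj_mem_deg n _⟩

lemma anchor_apply_of_mem {f : L.Forms} (hf : f ∈ L.pathModule) (t : k) :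
    L.anchor (f.1 t).1 = L.anchor (f.1 0).1 := by
  refine PolyFun.eq_of_der_eq_zero (k := k)
    (f := PolyFun.map (L.anchor ∘ₗ LinearMap.fst A L L) f) ?_ t
  rw [PolyFun.der_map]
  refine PolyFun.ext fun t => ?_
  show L.anchor ((PolyFun.der f).1 t).1 = 0
  have h := (mem_pathModule.1 hf).2 t
  rw [formsDiff_apply, map_add, ← diff_proj, proj_sgn, sgn_of_mem (proj_mem 0 _), pow_zero,
    one_smul, add_comm, add_eq_zero_iff_eq_neg] at h
  rw [← anchor_proj_zero, h, map_neg, neg_eq_zero]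
  exact L.anchor_br_one _

omit [CharZero k] in
lemma epsBr_smul (n : ℕ) (hn : n + 1 ≠ 2) (z : Fin (n + 1) → L × L) (a : A) :
    L.epsBr (n + 1) (Function.update z (Fin.last n) (a • z (Fin.last n)))
      = a • L.epsBr (n + 1) z := by
  have key : ∀ S : Fin (n + 1) → (L × L →ₗ[A] L),
      L.br (n + 1) (fun b => S b (Function.update z (Fin.last n) (a • z (Fin.last n)) b))
        = a • L.br (n + 1) fun b => S b (z b) := by
    intro S
    rw [← L.br_smul n hn]
    congr 1
    ext b
    by_cases h : b = Fin.last n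
    · subst h; simp
    · simp [h]
  refine Prod.ext ?_ ?_
  · exact key fun _ => LinearMap.fst A L L
  · rw [Prod.smul_snd, epsBr_snd, epsBr_snd, Finset.smul_sum]
    exact Finset.sum_congr rfl fun q _ => key (L.epsSlot q)

omit [CharZero k] in
lemma epsBr_leibniz (z z' : L × L) (a : A) (h : L.anchor z.2 = 0) :
    L.epsBr 2 ![z, a • z'] = a • L.epsBr 2 ![z, z'] + L.anchor z.1 a • z' := by
  have e : ∀ (S : Fin 2 → (L × L →ₗ[A] L)) (y : L × L),
      (fun b => S b (![z, y] b)) = ![S 0 z, S 1 y] := by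
    intro S y
    ext b; fin_cases b <;> rfl
  have key : ∀ S : Fin 2 → (L × L →ₗ[A] L),
      L.br 2 (fun b => S b (![z, a • z'] b))
        = a • L.br 2 (fun b => S b (![z, z'] b)) + L.anchor (S 0 z) a • S 1 z' := by
    intro S
    rw [e, e, map_smul, L.br_leibniz]
  refine Prod.ext ?_ ?_
  · exact key fun _ => LinearMap.fst A L L
  · rw [Prod.snd_add, Prod.smul_snd, Prod.smul_snd, epsBr_snd, epsBr_snd, Fin.sum_univ_two,
      Fin.sum_univ_two, key, key, epsSlot_self, h, epsSlot_of_lt (q := (1 : Fin 2)) (b := 0) (by decide),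
      epsSlot_self]
    simp [smul_add, add_assoc]

omit [CharZero k] in
lemma anchor_snd_of_mem {f : L.Forms} (hf : L.formsNeg f = 0) (t : k) :
    L.anchor (f.1 t).2 = 0 := by
  have h : L.proj 0 (f.1 t).2 = 0 := congrFun (congrArg Subtype.val hf) t
  rw [← anchor_proj_zero, h, map_zero]

variable (L)

/-- The module of paths. -/
def PathCarrier : Type v := L.pathModule

instance : AddCommGroup L.PathCarrier := inferInstanceAs (AddCommGroup L.pathModule)

instance : Module A L.PathCarrier := inferInstanceAs (Module A L.pathModule)

instance : Module k L.PathCarrier := inferInstanceAs (Module k L.pathModule)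

instance : IsScalarTower k A L.PathCarrier := inferInstanceAs (IsScalarTower k A L.pathModule)

/-- The form underlying a path. -/
def pathForm : L.PathCarrier →ₗ[A] L.Forms := L.pathModule.subtype

/-- The brackets of the path algebroid. -/
def pathBr (n : ℕ) : MultilinearMap k (fun _ : Fin n => L.PathCarrier) L.PathCarrier :=
  MultilinearMap.codRestrict
    ((L.formsBr n).compLinearMap fun _ => L.pathForm.restrictScalars k)
    (L.pathModule.restrictScalars k) fun f => formsBr_mem_pathModule n _ fun b => (f b).2

variable {L}

lemma coe_pathBr (n : ℕ) (f : Fin n → L.PathCarrier) :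
    (L.pathBr n f).1 = L.formsBr n fun b => (f b).1 := rfl

lemma formsBr_swap (n : ℕ) (d : Fin n → ℕ) (f : Fin n → L.Forms)
    (hf : ∀ b, f b ∈ L.formsDeg (d b)) (i j : Fin n) (hij : (i : ℕ) + 1 = j) :
    L.formsBr n (f ∘ Equiv.swap i j) = (-(-1 : ℤ) ^ (d i * d j)) • L.formsBr n f := by
  have hn : n ≠ 1 := by
    rintro rfl
    omega
  rw [formsBr_of_ne hn, formsBr_of_ne hn, ← KoszulSign.koszulSign_swap i j hij d]
  exact PolyFun.ext fun t => epsBr_perm n (Equiv.swap i j) d (fun b => (f b).1 t)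
    (fun b => (hf b t).1) fun b => (hf b t).2

lemma formsBr_smul (n : ℕ) (hn : n + 1 ≠ 2) (f : Fin (n + 1) → L.Forms) (a : A) :
    L.formsBr (n + 1) (Function.update f (Fin.last n) (a • f (Fin.last n)))
      = a • L.formsBr (n + 1) f := by
  cases n with
  | zero =>
    rw [formsBr_one, formsBr_one, ← map_smul]
    simp
  | succ n =>
    rw [formsBr_of_ne (by omega), formsBr_of_ne (by omega)]
    refine PolyFun.ext fun t => ?_
    refine Eq.trans ?_ (epsBr_smul (n + 1) hn (fun b => (f b).1 t) a)
    rw [PolyFun.mapMul_apply]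
    congr 1
    ext1 b
    by_cases h : b = Fin.last (n + 1)
    · subst h; simp
    · simp [h]

variable (L)

/-- The projection of paths to degree `n`. -/
def pathProj (n : ℕ) : L.PathCarrier →ₗ[A] L.PathCarrier :=
  (L.formsProj n).restrict fun _ hf => formsProj_mem hf n

/-- The paths of degree `n`. -/
def pathDeg (n : ℕ) : Submodule A L.PathCarrier := (L.formsDeg n).comap L.pathForm

lemma pathDeg_isInternal : DirectSum.IsInternal L.pathDeg := by
  refine isInternal_of_proj _ L.pathProj ?_ ?_ ?_ ?_
  · exact fun n f => formsProj_mem_deg n f.1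
  · intro n f hf
    refine Subtype.ext (PolyFun.ext fun t => ?_)
    exact Prod.ext (proj_of_mem (hf t).1) (proj_of_mem (hf t).2)
  · intro m n h f hf
    refine Subtype.ext (PolyFun.ext fun t => ?_)
    exact Prod.ext (proj_of_mem_of_ne h (hf t).1)
        (proj_of_mem_of_ne (fun e => h (Nat.succ_injective e)) (hf t).2)
  · intro f
    obtain ⟨N, hN⟩ := sum_formsProj_of_mem f.2
    exact ⟨N, Subtype.ext (hN.trans 
      (map_sum L.pathForm (fun n => L.pathProj n f) (Finset.range N)).symm)⟩

/-- The anchor of a path is the anchor of its starting point. -/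
def pathAnchor : L.PathCarrier →ₗ[A] Derivation k A A :=
  L.anchor ∘ₗ LinearMap.fst A L L ∘ₗ PolyFun.eval (0 : k) ∘ₗ L.pathForm

variable {L}

lemma pathAnchor_apply (f : L.PathCarrier) : L.pathAnchor f = L.anchor (f.1.1 0).1 := rfl

lemma pathBr_eq_zero (n : ℕ) (d : Fin n → ℕ) (f : Fin n → L.PathCarrier)
    (hf : ∀ b, f b ∈ L.pathDeg (d b)) (h : (∑ b, d b) + n < 2) : L.pathBr n f = 0 := by
  obtain rfl | rfl : n = 0 ∨ n = 1 := by omega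
  · exact Subtype.ext (formsBr_zero _)
  · have h0 : d 0 = 0 := by simp at h; omega
    have h1 : (f 0).1 ∈ L.formsDeg (d 0) := hf 0
    rw [h0] at h1
    exact Subtype.ext ((formsBr_one _).trans
      ((mem_pathModule_iff_of_mem_deg_zero h1).1 (f 0).2))

lemma jacobiator_pathBr (n : ℕ) (d : Fin n → ℕ) (f : Fin n → L.PathCarrier)
    (hf : ∀ b, f b ∈ L.pathDeg (d b)) : jacobiator L.pathBr n d f = 0 :=
  Subtype.ext <| (map_jacobiator (β' := L.formsBr) L.pathBr L.pathForm.toAddMonoidHom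
    (fun _ _ => rfl) n d f).trans (jacobiator_formsBr n d _ hf)

lemma pathBr_smul (n : ℕ) (hn : n + 1 ≠ 2) (f : Fin (n + 1) → L.PathCarrier) (a : A) :
    L.pathBr (n + 1) (Function.update f (Fin.last n) (a • f (Fin.last n)))
      = a • L.pathBr (n + 1) f := Subtype.ext <| by
  refine Eq.trans ?_ (formsBr_smul n hn (fun b => (f b).1) a)
  rw [coe_pathBr]
  congr 1
  ext1 b
  by_cases h : b = Fin.last n
  · subst h; simp; rfl
  · simp [h]

lemma pathBr_two_apply (f g : L.PathCarrier) (t : k) :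
    (L.pathBr 2 ![f, g]).1.1 t = L.epsBr 2 ![f.1.1 t, g.1.1 t] := by
  rw [coe_pathBr, formsBr_of_ne (by simp), PolyFun.mapMul_apply]
  congr 1
  ext1 b
  fin_cases b <;> rfl

lemma pathBr_one_apply (f : L.PathCarrier) :
    (L.pathBr 1 ![f]).1 = L.formsDiff f.1 := by
  rw [coe_pathBr, formsBr_one]
  rfl

lemma pathBr_leibniz (f g : L.PathCarrier) (a : A) :
    L.pathBr 2 ![f, a • g] = a • L.pathBr 2 ![f, g] + L.pathAnchor f a • g := by
  refine Subtype.ext <| PolyFun.ext fun t => ?_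
  have h := epsBr_leibniz (f.1.1 t) (g.1.1 t) a (anchor_snd_of_mem f.2.1 t)
  rw [anchor_apply_of_mem f.2 t, ← pathAnchor_apply, ← pathBr_two_apply] at h
  exact (pathBr_two_apply f (a • g) t).trans h

variable (L)

/-- The path algebroid: the good truncation of the polynomial forms with values in `L`. -/
def path : LInfAlgebroid.{0, u, v} k A where
  carrier := L.PathCarrier
  deg := L.pathDeg
  isInternal := L.pathDeg_isInternal
  br := L.pathBr
  anchor := L.pathAnchor
  br_mem n d f hf m hm := formsBr_mem n d (fun b => (f b).1) hf m hm
  br_eq_zero := pathBr_eq_zero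
  br_swap n d f hf i j hij := Subtype.ext (formsBr_swap n d (fun b => (f b).1) hf i j hij)
  jacobi := jacobiator_pathBr
  br_smul := pathBr_smul
  br_leibniz := pathBr_leibniz
  anchor_of_pos n hn f hf := L.anchor_of_pos n hn _ (hf 0).1
  anchor_br_one f := by
    rw [pathAnchor_apply, pathBr_one_apply, formsDiff_apply]
    exact L.anchor_br_one _
  anchor_br_two f g := by
    rw [pathAnchor_apply, pathBr_two_apply, epsBr_fst, pathAnchor_apply, pathAnchor_apply,
      ← L.anchor_br_two]
    congr 2
    ext1 b
    fin_cases b <;> rfl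

end LInfAlgebroid

namespace LInfAlgebroid

variable {k : Type} {A : Type u} [Field k] [CommRing A] [Algebra k A]

section Lifting

variable {L L' : LInfAlgebroid.{0, u, v} k A}

/-- Lifting against the inclusions of spheres into disks. -/
def LiftsDisks (f : L ⟶ L') : Prop :=
  (∀ y ∈ L'.deg 0, ∃ x ∈ L.deg 0, Hom.toLin f x = y) ∧
    ∀ n, ∀ y ∈ L'.deg (n + 1), ∀ x ∈ L.deg n, L.diff x = 0 → Hom.toLin f x = L'.diff y →
      ∃ x' ∈ L.deg (n + 1), L.diff x' = x ∧ Hom.toLin f x' = y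

lemma homologyMap_surjective_iff (f : L ⟶ L') (n : ℕ) :
    Function.Surjective (Hom.homologyMap f n) ↔
      ∀ y ∈ L'.deg n, L'.diff y = 0 → ∃ x ∈ L.deg n, L.diff x = 0 ∧
        ∃ b ∈ L'.deg (n + 1), L'.diff b = Hom.toLin f x - y := by
  constructor
  · intro h y hy hy'
    obtain ⟨x, hx⟩ := h (Submodule.Quotient.mk ⟨y, hy, LinearMap.mem_ker.2 hy'⟩)
    obtain ⟨⟨x, hx1, hx2⟩, rfl⟩ := Submodule.Quotient.mk_surjective _ x
    have := (Submodule.Quotient.eq _).1 hx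
    obtain ⟨b, hb, e⟩ := this
    exact ⟨x, hx1, LinearMap.mem_ker.1 hx2, b, hb, e⟩
  · intro h y
    obtain ⟨⟨y, hy, hy'⟩, rfl⟩ := Submodule.Quotient.mk_surjective _ y
    obtain ⟨x, hx, hx', b, hb, e⟩ := h y hy (LinearMap.mem_ker.1 hy')
    exact ⟨Submodule.Quotient.mk ⟨x, hx, LinearMap.mem_ker.2 hx'⟩,
      (Submodule.Quotient.eq _).2 ⟨b, hb, e⟩⟩

lemma homologyMap_injective_iff (f : L ⟶ L') (n : ℕ) :
    Function.Injective (Hom.homologyMap f n) ↔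
      ∀ x ∈ L.deg n, L.diff x = 0 → (∃ b ∈ L'.deg (n + 1), L'.diff b = Hom.toLin f x) →
        ∃ a ∈ L.deg (n + 1), L.diff a = x := by
  rw [← LinearMap.ker_eq_bot, LinearMap.ker_eq_bot']
  constructor
  · rintro h x hx hx' ⟨b, hb, e⟩
    have := h (Submodule.Quotient.mk ⟨x, hx, LinearMap.mem_ker.2 hx'⟩)
      ((Submodule.Quotient.mk_eq_zero _).2 ⟨b, hb, e⟩)
    obtain ⟨a, ha, e⟩ := (Submodule.Quotient.mk_eq_zero _).1 this
    exact ⟨a, ha, e⟩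
  · intro h x hx
    obtain ⟨⟨x, hx1, hx2⟩, rfl⟩ := Submodule.Quotient.mk_surjective _ x
    obtain ⟨b, hb, e⟩ := (Submodule.Quotient.mk_eq_zero _).1 hx
    obtain ⟨a, ha, e⟩ := h x hx1 (LinearMap.mem_ker.1 hx2) ⟨b, hb, e⟩
    exact (Submodule.Quotient.mk_eq_zero _).2 ⟨a, ha, e⟩

lemma LiftsDisks.exists_cycle {f : L ⟶ L'} (hf : LiftsDisks f) (n : ℕ) (y : L') (hy : y ∈ L'.deg n)
    (hy' : L'.diff y = 0) : ∃ x ∈ L.deg n, L.diff x = 0 ∧ Hom.toLin f x = y := by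
  cases n with
  | zero =>
    obtain ⟨x, hx, e⟩ := hf.1 y hy
    exact ⟨x, hx, diff_of_mem_zero hx, e⟩
  | succ n => exact hf.2 n y hy 0 (zero_mem _) (map_zero _) (by rw [map_zero, hy'])

lemma LiftsDisks.weakEquivalence {f : L ⟶ L'} (hf : LiftsDisks f) : WeakEquivalence f := by
  rw [weakEquivalence_iff]
  refine fun n => ⟨(homologyMap_injective_iff f n).2 ?_, (homologyMap_surjective_iff f n).2 ?_⟩
  · rintro x hx hx' ⟨b, hb, e⟩
    obtain ⟨a, ha, e, -⟩ := hf.2 n b hb x hx hx' e.symm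
    exact ⟨a, ha, e⟩
  · intro y hy hy'
    obtain ⟨x, hx, hx', e⟩ := hf.exists_cycle n y hy hy'
    exact ⟨x, hx, hx', 0, zero_mem _, by rw [e, sub_self, map_zero]⟩

lemma LiftsDisks.fibration {f : L ⟶ L'} (hf : LiftsDisks f) : Fibration f := by
  rw [fibration_iff]
  intro n hn y hy
  obtain ⟨n, rfl⟩ := Nat.exists_eq_succ_of_ne_zero hn.ne'
  obtain ⟨x, hx, hx', e⟩ := hf.exists_cycle n (L'.diff y) (diff_mem hy) (diff_diff y)
  obtain ⟨x', h1, -, h2⟩ := hf.2 n y hy x hx hx' e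
  exact ⟨x', h1, h2⟩

lemma LiftsDisks.trivialFibrations {f : L ⟶ L'} (hf : LiftsDisks f) : trivialFibrations _ f :=
  (mem_trivialFibrations_iff f).2 ⟨hf.fibration, hf.weakEquivalence⟩

/-- Trivial fibrations have the lifting property against inclusions of spheres into disks. -/
lemma LiftsDisks.of_fibration {f : L ⟶ L'} (hf : Fibration f) (hw : WeakEquivalence f) :
    LiftsDisks f := by
  have hf : ∀ n : ℕ, 0 < n → ∀ y ∈ L'.deg n, ∃ x ∈ L.deg n, Hom.toLin f x = y :=
    (fibration_iff f).1 hf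
  have hw : ∀ n : ℕ, Function.Bijective (Hom.homologyMap f n) := (weakEquivalence_iff f).1 hw
  have key : ∀ n, ∀ y ∈ L'.deg n, L'.diff y = 0 →
      ∃ x ∈ L.deg n, L.diff x = 0 ∧ Hom.toLin f x = y := by
    intro n y hy hy'
    obtain ⟨x, hx, hx', b, hb, e⟩ := (homologyMap_surjective_iff f n).1 (hw n).2 y hy hy'
    obtain ⟨c, hc, rfl⟩ := hf (n + 1) n.succ_pos b hb
    refine ⟨x - L.diff c, sub_mem hx (diff_mem hc), ?_, ?_⟩
    · rw [map_sub, hx', diff_diff, sub_zero]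
    · rw [map_sub, Hom.map_diff, e, sub_sub_cancel]
  refine ⟨fun y hy => ?_, fun n y hy x hx hx' e => ?_⟩
  · obtain ⟨x, hx, -, e⟩ := key 0 y hy (diff_of_mem_zero hy)
    exact ⟨x, hx, e⟩
  · obtain ⟨a, ha, rfl⟩ := (homologyMap_injective_iff f n).1 (hw n).1 x hx hx' ⟨y, hy, e.symm⟩
    obtain ⟨z, hz, hz', e'⟩ := key (n + 1) (y - Hom.toLin f a) (sub_mem hy (Hom.map_deg f _ _ ha))
      (by rw [map_sub, ← e, Hom.map_diff, sub_self])
    exact ⟨a + z, add_mem ha hz, by rw [map_add, hz', add_zero], by rw [map_add, e']; abel⟩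

/-- A weak equivalence with a section is a trivial fibration. -/
lemma LiftsDisks.of_section {f : L ⟶ L'} {s : L' ⟶ L} (hs : s ≫ f = 𝟙 L')
    (hw : WeakEquivalence f) : LiftsDisks f := by
  refine .of_fibration ((fibration_iff f).2 fun n _ y hy => ?_) hw
  exact ⟨Hom.toLin s y, Hom.map_deg s n y hy, congrArg (fun g => Hom.toLin g y) hs⟩

lemma LiftsDisks.comp {L'' : LInfAlgebroid.{0, u, v} k A} {f : L ⟶ L'} {g : L' ⟶ L''}
    (hf : LiftsDisks f) (hg : LiftsDisks g) : LiftsDisks (f ≫ g) := by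
  refine ⟨fun y hy => ?_, fun n y hy x hx hx' e => ?_⟩
  · obtain ⟨z, hz, rfl⟩ := hg.1 y hy
    obtain ⟨x, hx, rfl⟩ := hf.1 z hz
    exact ⟨x, hx, rfl⟩
  · obtain ⟨z, hz, hz', e'⟩ := hg.2 n y hy (Hom.toLin f x) (Hom.map_deg f n x hx)
      (by rw [← Hom.map_diff, hx', map_zero]) e
    obtain ⟨x', h1, h2, h3⟩ := hf.2 n z hz x hx hx' hz'.symm
    exact ⟨x', h1, h2, (congrArg (Hom.toLin g) h3).trans e'⟩

end Lifting

variable [CharZero k] (L : LInfAlgebroid.{0, u, v} k A) {L' : LInfAlgebroid.{0, u, v} k A}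

variable {L} in
lemma formsBr_apply_fst (n : ℕ) (f : Fin n → L.Forms) (t : k) :
    ((L.formsBr n f).1 t).1 = L.br n fun b => ((f b).1 t).1 := by
  by_cases hn : n = 1
  · subst hn
    rw [formsBr_one, formsDiff_apply]
    show L.br 1 _ = L.br 1 _
    congr 1
    ext b
    rw [Subsingleton.elim b 0]
    rfl
  · rw [formsBr_of_ne hn]
    rfl

/-- The evaluation of paths at a point of the line. -/
def pathEval (t : k) : L.path ⟶ L where
  toLin := LinearMap.fst A L L ∘ₗ PolyFun.eval t ∘ₗ L.pathForm
  map_deg _ _ hf := (hf t).1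
  map_br n f := formsBr_apply_fst n (fun b => (f b).1) t
  map_anchor f := anchor_apply_of_mem f.2 t

variable {L} in
/-- A path from a form in the truncation. -/
def mkPath (f : L.Forms) (hf : f ∈ L.pathModule) : L.path := ⟨f, hf⟩

lemma pathForm_injective : Function.Injective L.pathForm := Subtype.val_injective

lemma pathForm_diff (f : L.path) : L.pathForm (L.path.diff f) = L.formsDiff (L.pathForm f) :=
  pathBr_one_apply f

/-- The constant form. -/
def constForm : L →ₗ[A] L.Forms := PolyFun.mono k A 0 ∘ₗ LinearMap.inl A L L

variable {L}

omit [CharZero k] in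
lemma constForm_apply (x : L) (t : k) : (L.constForm x).1 t = (x, 0) := by
  simp [constForm]

lemma der_constForm (x : L) : PolyFun.der (L.constForm x) = 0 := by
  simp [constForm]

lemma constForm_mem (x : L) : L.constForm x ∈ L.pathModule := by
  rw [mem_pathModule]
  simp [formsDiff_apply, constForm_apply, der_constForm]

lemma formsBr_constForm (n : ℕ) (x : Fin n → L) :
    L.formsBr n (fun b => L.constForm (x b)) = L.constForm (L.br n x) := by
  refine PolyFun.ext fun t => ?_
  rw [constForm_apply]
  refine Prod.ext ?_ ?_
  · simp [formsBr_apply_fst, constForm_apply]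
  · by_cases hn : n = 1
    · subst hn
      simp [formsBr_one, formsDiff_apply, constForm_apply, der_constForm]
    · rw [formsBr_of_ne hn, PolyFun.mapMul_apply, epsBr_snd]
      refine Finset.sum_eq_zero fun q _ => (L.br n).map_coord_zero q ?_
      rw [epsSlot_self, constForm_apply]

variable (L) in
/-- The constant paths. -/
def pathConst : L ⟶ L.path where
  toLin := LinearMap.codRestrict L.pathModule L.constForm constForm_mem
  map_deg n x hx t := by
    show ((L.constForm x).1 t).1 ∈ _ ∧ ((L.constForm x).1 t).2 ∈ _
    rw [constForm_apply]
    exact ⟨hx, zero_mem _⟩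
  map_br n x := L.pathForm_injective (formsBr_constForm n x).symm
  map_anchor x := by
    show L.anchor ((L.constForm x).1 0).1 = _
    rw [constForm_apply]

@[simp]
lemma pathConst_pathEval (t : k) : L.pathConst ≫ L.pathEval t = 𝟙 L := by
  refine Hom.ext (LinearMap.ext fun x => ?_)
  show ((L.constForm x).1 t).1 = x
  rw [constForm_apply]

/-- The map on forms induced by a morphism. -/
def Hom.formsMap (f : Hom L L') : L.Forms →ₗ[A] L'.Forms :=
  PolyFun.map (LinearMap.prodMap f.toLin f.toLin)

omit [CharZero k] in
lemma Hom.formsMap_apply (f : Hom L L') (z : L.Forms) (t : k) :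
    (f.formsMap z).1 t = (f.toLin (z.1 t).1, f.toLin (z.1 t).2) := rfl

lemma Hom.formsMap_formsDiff (f : Hom L L') (z : L.Forms) :
    f.formsMap (L.formsDiff z) = L'.formsDiff (f.formsMap z) := by
  refine PolyFun.ext fun t => ?_
  have h := der_map_apply (LinearMap.prodMap f.toLin f.toLin) z t
  have h' : ((PolyFun.der (f.formsMap z)).1 t).1 = f.toLin ((PolyFun.der z).1 t).1 :=
    congrArg Prod.fst h
  simp [formsMap_apply, formsDiff_apply, h', f.map_diff, f.map_sgn]

lemma Hom.formsMap_mem (f : Hom L L') {z : L.Forms} (hz : z ∈ L.pathModule) :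
    f.formsMap z ∈ L'.pathModule := by
  rw [mem_pathModule] at hz ⊢
  refine ⟨fun t => ?_, fun t => ?_⟩
  · rw [formsMap_apply, ← f.map_proj, hz.1, map_zero]
  · rw [← formsMap_formsDiff, formsMap_apply, ← f.map_proj, hz.2, map_zero]

lemma Hom.formsMap_formsBr (f : Hom L L') (n : ℕ) (z : Fin n → L.Forms) :
    f.formsMap (L.formsBr n z) = L'.formsBr n fun b => f.formsMap (z b) := by
  by_cases hn : n = 1
  · subst hn
    rw [formsBr_one, formsBr_one, formsMap_formsDiff]
  · rw [formsBr_of_ne hn, formsBr_of_ne hn]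
    exact PolyFun.ext fun t => (f.map_epsBr n fun b => (z b).1 t).symm

/-- The map on path algebroids induced by a morphism. -/
def pathMap (f : L ⟶ L') : L.path ⟶ L'.path where
  toLin := LinearMap.codRestrict L'.pathModule (Hom.formsMap f ∘ₗ L.pathForm)
    fun z => Hom.formsMap_mem f z.2
  map_deg _ _ hz t := ⟨Hom.map_deg f _ _ (hz t).1, Hom.map_deg f _ _ (hz t).2⟩
  map_br n z := L'.pathForm_injective (Hom.formsMap_formsBr f n fun b => (z b).1)
  map_anchor z := Hom.map_anchor f (z.1.1 0).1

lemma pathMap_pathEval (f : L ⟶ L') (t : k) :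
    pathMap f ≫ L'.pathEval t = L.pathEval t ≫ f := rfl

/-- For a closed form `x + y dt`, the primitive of `± y` that vanishes at `0`. -/
def formsPrim : L.Forms →ₗ[A] PolyFun k A L :=
  PolyFun.int ∘ₗ PolyFun.map (L.sgn ∘ₗ LinearMap.snd A L L)

lemma der_formsPrim (f : L.Forms) (t : k) :
    (PolyFun.der (formsPrim f)).1 t = L.sgn (f.1 t).2 := by
  simp [formsPrim]

lemma formsPrim_zero (f : L.Forms) : (formsPrim f).1 0 = 0 := by simp [formsPrim]

lemma formsPrim_mem {n : ℕ} {f : L.Forms} (hf : f ∈ L.formsDeg n) (t : k) :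
    (formsPrim f).1 t ∈ L.deg (n + 1) := by
  have h : PolyFun.map (L.proj (n + 1)) (PolyFun.map (L.sgn ∘ₗ LinearMap.snd A L L) f)
      = PolyFun.map (L.sgn ∘ₗ LinearMap.snd A L L) f :=
    PolyFun.ext fun t => proj_of_mem (sgn_mem (hf t).2)
  have h1 := PolyFun.int_map (L.proj (n + 1)) (PolyFun.map (L.sgn ∘ₗ LinearMap.snd A L L) f)
  rw [h] at h1
  have h2 : (formsPrim f).1 t = L.proj (n + 1) ((formsPrim f).1 t) :=
    congrFun (congrArg Subtype.val h1) t
  rw [h2]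
  exact proj_mem _ _

lemma Hom.map_formsPrim (g : Hom L L') (f : L.Forms) (t : k) :
    g.toLin ((formsPrim f).1 t) = (formsPrim (g.formsMap f)).1 t := by
  have h1 := PolyFun.int_map g.toLin (PolyFun.map (L.sgn ∘ₗ LinearMap.snd A L L) f)
  have e : PolyFun.map (L'.sgn ∘ₗ LinearMap.snd A L' L') (g.formsMap f)
      = PolyFun.map g.toLin (PolyFun.map (L.sgn ∘ₗ LinearMap.snd A L L) f) :=
    PolyFun.ext fun t => (g.map_sgn _).symm
  unfold formsPrim
  rw [LinearMap.comp_apply, LinearMap.comp_apply, e, h1]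
  rfl

lemma diff_formsPrim {f : L.Forms} (hf : L.formsDiff f = 0) (t : k) :
    L.diff ((formsPrim f).1 t) = (f.1 t).1 - (f.1 0).1 := by
  have h1 := PolyFun.int_map L.diff (PolyFun.map (L.sgn ∘ₗ LinearMap.snd A L L) f)
  have e : PolyFun.map L.diff (PolyFun.map (L.sgn ∘ₗ LinearMap.snd A L L) f)
      = PolyFun.der (PolyFun.map (LinearMap.fst A L L) f) := by
    refine PolyFun.ext fun t => ?_
    rw [der_map_apply]
    show L.diff (L.sgn (f.1 t).2) = ((PolyFun.der f).1 t).1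
    have h : ((L.formsDiff f).1 t).2 = 0 := by rw [hf]; rfl
    rw [formsDiff_apply] at h
    rw [diff_sgn, eq_neg_of_add_eq_zero_left h, map_neg, neg_neg, sgn_sgn]
  rw [e, PolyFun.int_der] at h1
  have := congrFun (congrArg Subtype.val h1) t
  refine this.symm.trans ?_
  simp

/-- The form with differential `f` that starts at `c` and differs from a primitive by a multiple of a
boundary. -/
def fillForm (f : L.Forms) (c e u : L) : L.Forms :=
  PolyFun.mono k A 0 (c, L.sgn u) + PolyFun.map (LinearMap.inl A L L) (formsPrim f)
    + PolyFun.mono k A 1 (e, 0)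

lemma fillForm_apply (f : L.Forms) (c e u : L) (t : k) :
    (fillForm f c e u).1 t = (c + (formsPrim f).1 t + t • e, L.sgn u) := by
  simp [fillForm]

lemma der_fillForm (f : L.Forms) (c e u : L) (t : k) :
    ((PolyFun.der (fillForm f c e u)).1 t).1 = L.sgn (f.1 t).2 + e := by
  have h := der_map_apply (LinearMap.inl A L L) (formsPrim f) t
  rw [der_formsPrim] at h
  unfold fillForm
  rw [map_add, map_add]
  simp [h]

lemma formsDiff_fillForm {f : L.Forms} (hf : L.formsDiff f = 0) {c e u : L}
    (hc : L.diff c = (f.1 0).1) (hu : L.diff u = e) :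
    L.formsDiff (fillForm f c e u) = f := by
  refine PolyFun.ext fun t => ?_
  rw [formsDiff_apply, der_fillForm, fillForm_apply]
  have he : L.diff e = 0 := by rw [← hu, diff_diff]
  have hs : L.diff (t • e) = 0 := by rw [LinearMap.map_smul_of_tower, he, smul_zero]
  refine Prod.ext ?_ ?_
  · simp only [map_add, hc, diff_formsPrim hf, hs]
    abel
  · simp only [map_add, sgn_sgn, diff_sgn, hu]
    abel

lemma fillForm_mem {n : ℕ} {f : L.Forms} (hf : f ∈ L.formsDeg n) {c e u : L}
    (hc : c ∈ L.deg (n + 1)) (he : e ∈ L.deg (n + 1)) (hu : u ∈ L.deg (n + 2)) :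
    fillForm f c e u ∈ L.formsDeg (n + 1) := by
  intro t
  rw [fillForm_apply]
  exact ⟨add_mem (add_mem hc (formsPrim_mem hf t)) (Submodule.smul_of_tower_mem _ t he),
    sgn_mem hu⟩

/-- The evaluation of paths at the starting point is a trivial fibration. -/
lemma liftsDisks_pathEval_zero : LiftsDisks (L.pathEval 0) := by
  refine ⟨fun y hy => ⟨Hom.toLin L.pathConst y, Hom.map_deg L.pathConst 0 y hy, ?_⟩,
    fun n y hy x hx hx' e => ?_⟩
  · exact congrArg (fun g => Hom.toLin g y) (pathConst_pathEval (L := L) 0)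
  · have hd : L.formsDiff (L.pathForm x) = 0 := 
      (pathForm_diff L x).symm.trans ((congrArg L.pathForm hx').trans (map_zero L.pathForm))
    have hm := fillForm_mem hx hy (zero_mem _) (zero_mem _)
    refine ⟨mkPath (fillForm (L.pathForm x) y 0 0) (mem_pathModule_of_mem_deg hm n.succ_pos), hm,
      L.pathForm_injective ?_, ?_⟩
    · rw [pathForm_diff]
      exact formsDiff_fillForm hd e.symm (map_zero _)
    · show ((fillForm (L.pathForm x) y 0 0).1 0).1 = y
      rw [fillForm_apply, formsPrim_zero]
      simp

end LInfAlgebroid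

namespace LInfAlgebroid

variable {k : Type} {A : Type u} [Field k] [CommRing A] [Algebra k A]

section Pullback

variable {X Y Z : LInfAlgebroid.{0, u, v} k A} (f : X ⟶ Z) (g : Y ⟶ Z)

/-- The module of pairs with the same image. -/
def pullbackModule : Submodule A (X × Y) :=
  LinearMap.eqLocus (Hom.toLin f ∘ₗ LinearMap.fst A X Y) (Hom.toLin g ∘ₗ LinearMap.snd A X Y)

/-- The carrier of the fiber product. -/
def PullbackCarrier : Type v := pullbackModule f g

instance : AddCommGroup (PullbackCarrier f g) := inferInstanceAs (AddCommGroup (pullbackModule f g))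

instance : Module A (PullbackCarrier f g) := inferInstanceAs (Module A (pullbackModule f g))

instance : Module k (PullbackCarrier f g) := inferInstanceAs (Module k (pullbackModule f g))

instance : IsScalarTower k A (PullbackCarrier f g) :=
  inferInstanceAs (IsScalarTower k A (pullbackModule f g))

/-- The inclusion into the product. -/
def pullbackIncl : PullbackCarrier f g →ₗ[A] X × Y := (pullbackModule f g).subtype

variable {f g}

lemma pullback_ext {z z' : PullbackCarrier f g} (h1 : z.1.1 = z'.1.1) (h2 : z.1.2 = z'.1.2) :
    z = z' := Subtype.ext (Prod.ext h1 h2)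

lemma pullback_condition (z : PullbackCarrier f g) : Hom.toLin f z.1.1 = Hom.toLin g z.1.2 := z.2

variable (f g)

/-- The brackets of the fiber product. -/
def pullbackBr (n : ℕ) :
    MultilinearMap k (fun _ : Fin n => PullbackCarrier f g) (PullbackCarrier f g) :=
  MultilinearMap.codRestrict
    (((X.br n).compLinearMap fun _ =>
        (LinearMap.fst A X Y ∘ₗ pullbackIncl f g).restrictScalars k).prod
      ((Y.br n).compLinearMap fun _ =>
        (LinearMap.snd A X Y ∘ₗ pullbackIncl f g).restrictScalars k))
    ((pullbackModule f g).restrictScalars k) fun z => by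
      show Hom.toLin f (X.br n fun b => (z b).1.1) = Hom.toLin g (Y.br n fun b => (z b).1.2)
      rw [Hom.map_br, Hom.map_br]
      exact congrArg _ (funext fun b => (z b).2)

/-- The elements of degree `n` of the fiber product. -/
def pullbackDeg (n : ℕ) : Submodule A (PullbackCarrier f g) :=
  ((X.deg n).prod (Y.deg n)).comap (pullbackIncl f g)

/-- The projection of the fiber product to degree `n`. -/
def pullbackProj (n : ℕ) : PullbackCarrier f g →ₗ[A] PullbackCarrier f g :=
  LinearMap.restrict (p := pullbackModule f g) (q := pullbackModule f g)
    (LinearMap.prodMap (X.proj n) (Y.proj n)) fun z hz => by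
      show Hom.toLin f (X.proj n z.1) = Hom.toLin g (Y.proj n z.2)
      rw [Hom.map_proj, Hom.map_proj]
      exact congrArg _ hz

lemma pullbackDeg_isInternal : DirectSum.IsInternal (pullbackDeg f g) := by
  refine isInternal_of_proj _ (pullbackProj f g) ?_ ?_ ?_ ?_
  · exact fun n z => ⟨proj_mem _ _, proj_mem _ _⟩
  · exact fun n z hz => pullback_ext (proj_of_mem hz.1) (proj_of_mem hz.2)
  · exact fun m n h z hz => pullback_ext (proj_of_mem_of_ne h hz.1) (proj_of_mem_of_ne h hz.2)
  · intro z
    obtain ⟨N, hN⟩ := sum_proj z.1.1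
    obtain ⟨N', hN'⟩ := sum_proj z.1.2
    refine ⟨max N N', pullback_ext ?_ ?_⟩
    · exact (hN _ (le_max_left _ _)).trans
        (map_sum (LinearMap.fst A X Y ∘ₗ pullbackIncl f g) (fun n => pullbackProj f g n z) _).symm
    · exact (hN' _ (le_max_right _ _)).trans
        (map_sum (LinearMap.snd A X Y ∘ₗ pullbackIncl f g) (fun n => pullbackProj f g n z) _).symm

/-- The values of a linear map on a tuple in which the last entry is multiplied by a scalar. -/
lemma comp_update_smul {M N : Type*} [AddCommGroup M] [Module A M] [AddCommGroup N] [Module A N]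
    (S : M →ₗ[A] N) (n : ℕ) (x : Fin (n + 1) → M) (a : A) :
    (fun b => S (Function.update x (Fin.last n) (a • x (Fin.last n)) b))
      = Function.update (fun b => S (x b)) (Fin.last n) (a • S (x (Fin.last n))) := by
  ext b
  by_cases h : b = Fin.last n
  · subst h; simp
  · simp [h]

/-- The values of a linear map on a pair. -/
lemma comp_pair {M N : Type*} (S : M → N) (x y : M) :
    (fun b => S (![x, y] b)) = ![S x, S y] := by
  ext b; fin_cases b <;> rfl

/-- The fiber product of `L_∞`-algebroids. -/
def pullbackAlgebroid : LInfAlgebroid.{0, u, v} k A where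
  carrier := PullbackCarrier f g
  deg := pullbackDeg f g
  isInternal := pullbackDeg_isInternal f g
  br := pullbackBr f g
  anchor := X.anchor ∘ₗ LinearMap.fst A X Y ∘ₗ pullbackIncl f g
  br_mem n d z hz m hm :=
    ⟨X.br_mem n d _ (fun b => (hz b).1) m hm, Y.br_mem n d _ (fun b => (hz b).2) m hm⟩
  br_eq_zero n d z hz h := pullback_ext (X.br_eq_zero n d _ (fun b => (hz b).1) h)
    (Y.br_eq_zero n d _ (fun b => (hz b).2) h)
  br_swap n d z hz i j hij := pullback_ext (X.br_swap n d _ (fun b => (hz b).1) i j hij)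
    (Y.br_swap n d _ (fun b => (hz b).2) i j hij)
  jacobi n d z hz := by
    have h : jacobiator (pullbackBr f g) n d z = 0 := pullback_ext
      ((map_jacobiator (β' := X.br) (pullbackBr f g)
        (LinearMap.fst A X Y ∘ₗ pullbackIncl f g).toAddMonoidHom (fun _ _ => rfl) n d z).trans
        (jacobiator_br n d _ fun b => (hz b).1))
      ((map_jacobiator (β' := Y.br) (pullbackBr f g)
        (LinearMap.snd A X Y ∘ₗ pullbackIncl f g).toAddMonoidHom (fun _ _ => rfl) n d z).trans
        (jacobiator_br n d _ fun b => (hz b).2))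
    exact h
  br_smul n hn z a := pullback_ext
    ((congrArg (X.br (n + 1))
      (comp_update_smul (LinearMap.fst A X Y ∘ₗ pullbackIncl f g) n z a)).trans
      (X.br_smul n hn (fun b => (z b).1.1) a))
    ((congrArg (Y.br (n + 1))
      (comp_update_smul (LinearMap.snd A X Y ∘ₗ pullbackIncl f g) n z a)).trans
      (Y.br_smul n hn (fun b => (z b).1.2) a))
  br_leibniz z z' a := by
    have e1 : ∀ z z' : PullbackCarrier f g,
        (pullbackBr f g 2 ![z, z']).1.1 = X.br 2 ![z.1.1, z'.1.1] := fun z z' =>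
      congrArg (X.br 2) (comp_pair (LinearMap.fst A X Y ∘ₗ pullbackIncl f g) z z')
    have e2 : ∀ z z' : PullbackCarrier f g,
        (pullbackBr f g 2 ![z, z']).1.2 = Y.br 2 ![z.1.2, z'.1.2] := fun z z' =>
      congrArg (Y.br 2) (comp_pair (LinearMap.snd A X Y ∘ₗ pullbackIncl f g) z z')
    refine pullback_ext ?_ ?_
    · refine (e1 _ _).trans ((X.br_leibniz z.1.1 z'.1.1 a).trans ?_)
      rw [← e1]; rfl
    · refine (e2 _ _).trans ((Y.br_leibniz z.1.2 z'.1.2 a).trans ?_)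
      rw [← e2, ← Hom.map_anchor g, ← pullback_condition, Hom.map_anchor f]; rfl
  anchor_of_pos n hn z hz := X.anchor_of_pos n hn _ hz.1
  anchor_br_one z := by
    have e : (fun b => (![z] b : PullbackCarrier f g).1.1) = ![z.1.1] := by
      ext b; fin_cases b; rfl
    exact (congrArg (fun y => X.anchor (X.br 1 y)) e).trans (X.anchor_br_one z.1.1)
  anchor_br_two z z' :=
    (congrArg (fun y => X.anchor (X.br 2 y))
      (comp_pair (LinearMap.fst A X Y ∘ₗ pullbackIncl f g) z z')).trans
      (X.anchor_br_two z.1.1 z'.1.1)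

/-- The first projection of the fiber product. -/
def pullbackFst : pullbackAlgebroid f g ⟶ X where
  toLin := LinearMap.fst A X Y ∘ₗ pullbackIncl f g
  map_deg _ _ hz := hz.1
  map_br _ _ := rfl
  map_anchor _ := rfl

/-- The second projection of the fiber product. -/
def pullbackSnd : pullbackAlgebroid f g ⟶ Y where
  toLin := LinearMap.snd A X Y ∘ₗ pullbackIncl f g
  map_deg _ _ hz := hz.2
  map_br _ _ := rfl
  map_anchor z := by
    have h : Z.anchor (Hom.toLin f z.1.1) = Z.anchor (Hom.toLin g z.1.2) :=
      congrArg _ (pullback_condition z)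
    rw [Hom.map_anchor, Hom.map_anchor] at h
    exact h.symm

variable {f g}

/-- The morphism to the fiber product given by a commutative square. -/
def pullbackLift {W : LInfAlgebroid.{0, u, v} k A} (a : W ⟶ X) (b : W ⟶ Y) (h : a ≫ f = b ≫ g) :
    W ⟶ pullbackAlgebroid f g where
  toLin := LinearMap.codRestrict (pullbackModule f g) (LinearMap.prod (Hom.toLin a) (Hom.toLin b))
    fun x => congrArg (fun m => Hom.toLin m x) h
  map_deg n x hx := ⟨Hom.map_deg a n x hx, Hom.map_deg b n x hx⟩
  map_br n x := pullback_ext (Hom.map_br a n x) (Hom.map_br b n x)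
  map_anchor x := Hom.map_anchor a x

@[simp]
lemma pullbackLift_fst {W : LInfAlgebroid.{0, u, v} k A} (a : W ⟶ X) (b : W ⟶ Y)
    (h : a ≫ f = b ≫ g) : pullbackLift a b h ≫ pullbackFst f g = a := rfl

@[simp]
lemma pullbackLift_fst_assoc {W V : LInfAlgebroid.{0, u, v} k A} (a : W ⟶ X) (b : W ⟶ Y)
    (h : a ≫ f = b ≫ g) (c : X ⟶ V) : pullbackLift a b h ≫ pullbackFst f g ≫ c = a ≫ c := rfl

@[simp]
lemma pullbackLift_snd {W : LInfAlgebroid.{0, u, v} k A} (a : W ⟶ X) (b : W ⟶ Y)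
    (h : a ≫ f = b ≫ g) : pullbackLift a b h ≫ pullbackSnd f g = b := rfl

@[simp]
lemma pullbackLift_snd_assoc {W V : LInfAlgebroid.{0, u, v} k A} (a : W ⟶ X) (b : W ⟶ Y)
    (h : a ≫ f = b ≫ g) (c : Y ⟶ V) : pullbackLift a b h ≫ pullbackSnd f g ≫ c = b ≫ c := rfl

lemma pullback_comm : pullbackFst f g ≫ f = pullbackSnd f g ≫ g :=
  Hom.ext (LinearMap.ext fun z => pullback_condition z)

lemma pullback_comm_assoc {V : LInfAlgebroid.{0, u, v} k A} (c : Z ⟶ V) :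
    pullbackFst f g ≫ f ≫ c = pullbackSnd f g ≫ g ≫ c := by
  rw [← Category.assoc, pullback_comm, Category.assoc]

/-- A pair as an element of the fiber product. -/
def mkPullback (x : X) (y : Y) (h : Hom.toLin f x = Hom.toLin g y) : pullbackAlgebroid f g :=
  ⟨(x, y), h⟩

lemma pullback_diff_fst (z : pullbackAlgebroid f g) :
    ((pullbackAlgebroid f g).diff z).1.1 = X.diff z.1.1 :=
  Hom.map_diff (pullbackFst f g) z

lemma pullback_diff_snd (z : pullbackAlgebroid f g) :
    ((pullbackAlgebroid f g).diff z).1.2 = Y.diff z.1.2 :=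
  Hom.map_diff (pullbackSnd f g) z

/-- Trivial fibrations are stable under base change. -/
lemma LiftsDisks.pullbackFst (hg : LiftsDisks g) : LiftsDisks (pullbackFst f g) := by
  refine ⟨fun x hx => ?_, fun n x hx z hz hz' e => ?_⟩
  · obtain ⟨y, hy, e⟩ := hg.1 (Hom.toLin f x) (Hom.map_deg f 0 x hx)
    exact ⟨mkPullback x y e.symm, ⟨hx, hy⟩, rfl⟩
  · have h2 : Y.diff z.1.2 = 0 := by rw [← pullback_diff_snd, hz']; rfl
    have e' : z.1.1 = X.diff x := e
    obtain ⟨y, hy, hy', e2⟩ := hg.2 n (Hom.toLin f x) (Hom.map_deg f _ x hx) z.1.2 hz.2 h2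
      (by rw [← Hom.map_diff, ← e']; exact (pullback_condition z).symm)
    refine ⟨mkPullback x y e2.symm, ⟨hx, hy⟩, pullback_ext ?_ ?_, rfl⟩
    · rw [pullback_diff_fst]; exact e.symm
    · rw [pullback_diff_snd]; exact hy'

end Pullback

section Homotopy

variable [CharZero k] {L C X : LInfAlgebroid.{0, u, v} k A}

/-- The algebroid of paths in the fibers of a morphism. -/
abbrev fiberPath (p : C ⟶ L) : LInfAlgebroid.{0, u, v} k A :=
  pullbackAlgebroid (pathMap p) L.pathConst

/-- The endpoints of a path in a fiber. -/
def fiberPathEnds (p : C ⟶ L) : fiberPath p ⟶ pullbackAlgebroid p p :=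
  pullbackLift (pullbackFst (pathMap p) L.pathConst ≫ C.pathEval 0)
    (pullbackFst (pathMap p) L.pathConst ≫ C.pathEval 1) (by
      rw [Category.assoc, Category.assoc, ← pathMap_pathEval, ← pathMap_pathEval,
        pullback_comm_assoc, pullback_comm_assoc, pathConst_pathEval, pathConst_pathEval])

lemma pathMap_mkPath_eq_pathConst (p : C ⟶ L) {f : C.Forms} (hf : f ∈ C.pathModule) (l : L)
    (h1 : ∀ t, Hom.toLin p (f.1 t).1 = l) (h2 : ∀ t, Hom.toLin p (f.1 t).2 = 0) :
    Hom.toLin (pathMap p) (mkPath f hf) = Hom.toLin L.pathConst l := by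
  refine L.pathForm_injective (PolyFun.ext fun t => ?_)
  refine Eq.trans ?_ (constForm_apply l t).symm
  exact Prod.ext (h1 t) (h2 t)

/-- If a morphism is a trivial fibration, then so is the restriction of the paths in its fibers to
their endpoints. -/
lemma LiftsDisks.fiberPathEnds {p : C ⟶ L} (hp : LiftsDisks p) : LiftsDisks (fiberPathEnds p) := by
  refine ⟨fun c hc => ?_, fun n c hc z hz hz' hzc => ?_⟩
  · have hpc : Hom.toLin p (c.1.2 - c.1.1) = 0 := by
      rw [map_sub, pullback_condition c, sub_self]
    obtain ⟨u, hu, hu', hpu⟩ := hp.2 0 0 (zero_mem _) (c.1.2 - c.1.1) (sub_mem hc.2 hc.1)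
      (diff_of_mem_zero (sub_mem hc.2 hc.1)) (by rw [hpc, map_zero])
    have hpe : Hom.toLin p (C.diff u) = 0 := by rw [hu', hpc]
    let f : C.Forms := fillForm 0 c.1.1 (C.diff u) (C.sgn (-u))
    have hft : ∀ t, f.1 t = (c.1.1 + t • C.diff u, -u) := by
      intro t
      rw [fillForm_apply, sgn_sgn]
      simp [formsPrim]
    have hf0 : f ∈ C.formsDeg 0 := fun t => by
      rw [hft]
      exact ⟨add_mem hc.1 (Submodule.smul_of_tower_mem _ t (diff_mem hu)), neg_mem hu⟩
    have hder : ∀ t, ((PolyFun.der f).1 t).1 = C.diff u := fun t => by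
      rw [der_fillForm]; simp
    have hf : f ∈ C.pathModule := by
      rw [mem_pathModule_iff_of_mem_deg_zero hf0]
      refine PolyFun.ext fun t => ?_
      rw [formsDiff_apply, hder, hft]
      refine Prod.ext ?_ ?_
      · simp only [map_add, LinearMap.map_smul_of_tower, diff_diff, smul_zero, add_zero]
        exact diff_of_mem_zero hc.1
      · simp [sgn_of_mem (diff_mem hu)]
    refine ⟨mkPullback (mkPath f hf) (Hom.toLin p c.1.1)
      (pathMap_mkPath_eq_pathConst p hf _ (fun t => ?_) fun t => ?_), ⟨hf0, Hom.map_deg p _ _ hc.1⟩,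
      pullback_ext ?_ ?_⟩
    · rw [hft, map_add, LinearMap.map_smul_of_tower, hpe, smul_zero, add_zero]
    · rw [hft, map_neg, hpu, neg_zero]
    · show (f.1 0).1 = c.1.1
      rw [hft]; simp
    · show (f.1 1).1 = c.1.2
      rw [hft, hu']; simp
  · let x : C.Forms := C.pathForm z.1.1
    have hx : x ∈ C.formsDeg n := hz.1
    have hd : C.formsDiff x = 0 := by
      have h1 : C.path.diff z.1.1 = 0 := by
        exact (pullback_diff_fst z).symm.trans
          (congrArg (fun w : PullbackCarrier (pathMap p) L.pathConst => w.1.1) hz')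
      exact (pathForm_diff C z.1.1).symm.trans
        ((congrArg C.pathForm h1).trans (map_zero C.pathForm))
    have hc0 : (x.1 0).1 = C.diff c.1.1 :=
      (congrArg (fun w : PullbackCarrier p p => w.1.1) hzc).trans (pullback_diff_fst c)
    have hc1 : (x.1 1).1 = C.diff c.1.2 :=
      (congrArg (fun w : PullbackCarrier p p => w.1.2) hzc).trans (pullback_diff_snd c)
    have hcond : Hom.formsMap p x = L.constForm z.1.2 :=
      congrArg L.pathForm (pullback_condition z)
    have hpx : ∀ t, (Hom.toLin p (x.1 t).1, Hom.toLin p (x.1 t).2) = (z.1.2, (0 : L)) := fun t =>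
      (congrFun (congrArg Subtype.val hcond) t).trans (constForm_apply _ t)
    have hprim : ∀ t, Hom.toLin p ((formsPrim x).1 t) = 0 := by
      intro t
      rw [Hom.map_formsPrim, hcond]
      have : PolyFun.map (L.sgn ∘ₗ LinearMap.snd A L L) (L.constForm z.1.2) = 0 :=
        PolyFun.ext fun t => by simp [constForm_apply]
      simp [formsPrim, this]
    let e : C := c.1.2 - c.1.1 - (formsPrim x).1 1
    have he : e ∈ C.deg (n + 1) := sub_mem (sub_mem hc.2 hc.1) (formsPrim_mem hx 1)
    have hde : C.diff e = 0 := by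
      rw [map_sub, map_sub, diff_formsPrim hd, hc0, hc1, sub_self]
    have hpe : Hom.toLin p e = 0 := by
      rw [map_sub, map_sub, hprim, pullback_condition c, sub_self, sub_self]
    obtain ⟨u, hu, hu', hpu⟩ := hp.2 (n + 1) 0 (zero_mem _) e he hde (by rw [hpe, map_zero])
    have hm := fillForm_mem hx hc.1 he hu
    have hf := mem_pathModule_of_mem_deg hm n.succ_pos
    refine ⟨mkPullback (mkPath _ hf) (Hom.toLin p c.1.1)
      (pathMap_mkPath_eq_pathConst p hf _ (fun t => ?_) fun t => ?_), ⟨hm, Hom.map_deg p _ _ hc.1⟩,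
      pullback_ext ?_ ?_, pullback_ext ?_ ?_⟩
    · rw [fillForm_apply, map_add, map_add, hprim, LinearMap.map_smul_of_tower, hpe, smul_zero,
        add_zero, add_zero]
      rfl
    · rw [fillForm_apply, Hom.map_sgn, hpu, map_zero]
    · rw [pullback_diff_fst]
      refine C.pathForm_injective ((pathForm_diff C _).trans ?_)
      exact formsDiff_fillForm hd hc0.symm hu'
    · rw [pullback_diff_snd]
      show L.diff (Hom.toLin p c.1.1) = z.1.2
      rw [← Hom.map_diff, ← hc0]
      exact congrArg Prod.fst (hpx 0)
    · show ((fillForm x c.1.1 e u).1 0).1 = c.1.1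
      rw [fillForm_apply, formsPrim_zero]
      simp
    · show ((fillForm x c.1.1 e u).1 1).1 = c.1.2
      rw [fillForm_apply]
      simp [e]

omit [CharZero k] in
/-- Morphisms out of a cofibrant object lift along trivial fibrations. -/
lemma exists_lift_of_isCofibrant (hL : IsCofibrant L) {Y : LInfAlgebroid.{0, u, v} k A}
    {p : C ⟶ Y} (hp : LiftsDisks p) (g : L ⟶ Y) : ∃ h : L ⟶ C, h ≫ p = g := by
  have h : (HomotopicalAlgebra.trivialFibrations (LInfAlgebroid.{0, u, v} k A)).llp
      (initial.to L) := (cofibration_iff _).1 hL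
  have := h p hp.trivialFibrations
  have sq : CommSq (initial.to C) (initial.to L) p g := ⟨initial.hom_ext _ _⟩
  exact ⟨sq.lift, sq.fac_right⟩

omit [CharZero k] in
lemma leftHomotopyRel_iff (f g : L ⟶ X) :
    LeftHomotopyRel f g ↔ ∃ (C : LInfAlgebroid.{0, u, v} k A) (i₀ i₁ : L ⟶ C) (p : C ⟶ L)
      (H : C ⟶ X), LiftsDisks p ∧ i₀ ≫ p = 𝟙 L ∧ i₁ ≫ p = 𝟙 L ∧ i₀ ≫ H = f ∧ i₁ ≫ H = g := by
  constructor
  · rintro ⟨P, ⟨h⟩⟩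
    exact ⟨P.I, P.i₀, P.i₁, P.π, h.h, .of_section P.i₀_π P.weakEquivalence_π, P.i₀_π, P.i₁_π,
      h.h₀, h.h₁⟩
  · rintro ⟨C, i₀, i₁, p, H, hp, h₀, h₁, hf, hg⟩
    exact ⟨⟨⟨C, i₀, i₁, p, h₀, h₁⟩, hp.weakEquivalence⟩, ⟨⟨H, hf, hg⟩⟩⟩

omit [CharZero k] in
lemma leftHomotopyRel_refl (f : L ⟶ X) : LeftHomotopyRel f f := by
  refine (leftHomotopyRel_iff f f).2 ⟨L, 𝟙 L, 𝟙 L, 𝟙 L, f, ⟨fun y hy => ⟨y, hy, rfl⟩, ?_⟩,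
    Category.id_comp _, Category.id_comp _, Category.id_comp _, Category.id_comp _⟩
  exact fun n y hy x _ _ e => ⟨y, hy, e.symm, rfl⟩

omit [CharZero k] in
lemma leftHomotopyRel_symm {f g : L ⟶ X} (h : LeftHomotopyRel f g) : LeftHomotopyRel g f := by
  rw [leftHomotopyRel_iff] at h ⊢
  obtain ⟨C, i₀, i₁, p, H, hp, h₀, h₁, hf, hg⟩ := h
  exact ⟨C, i₁, i₀, p, H, hp, h₁, h₀, hg, hf⟩

omit [CharZero k] in
lemma leftHomotopyRel_postcomp {Y : LInfAlgebroid.{0, u, v} k A} {f f' : L ⟶ X}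
    (h : LeftHomotopyRel f f') (g : X ⟶ Y) : LeftHomotopyRel (f ≫ g) (f' ≫ g) := by
  rw [leftHomotopyRel_iff] at h ⊢
  obtain ⟨C, i₀, i₁, p, H, hp, h₀, h₁, rfl, rfl⟩ := h
  exact ⟨C, i₀, i₁, p, H ≫ g, hp, h₀, h₁, (Category.assoc _ _ _).symm, (Category.assoc _ _ _).symm⟩

omit [CharZero k] in
/-- A cylinder can be pulled back along any morphism. -/
lemma leftHomotopyRel_precomp {K : LInfAlgebroid.{0, u, v} k A} {f f' : L ⟶ X} (g : K ⟶ L)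
    (h : LeftHomotopyRel f f') : LeftHomotopyRel (g ≫ f) (g ≫ f') := by
  rw [leftHomotopyRel_iff] at h ⊢
  obtain ⟨C, i₀, i₁, p, H, hp, h₀, h₁, rfl, rfl⟩ := h
  have e : ∀ i : L ⟶ C, i ≫ p = 𝟙 L → 𝟙 K ≫ g = (g ≫ i) ≫ p := fun i hi => by
    rw [Category.assoc, hi, Category.comp_id, Category.id_comp]
  refine ⟨pullbackAlgebroid g p, pullbackLift (𝟙 K) (g ≫ i₀) (e _ h₀),
    pullbackLift (𝟙 K) (g ≫ i₁) (e _ h₁), pullbackFst g p, pullbackSnd g p ≫ H, hp.pullbackFst,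
    rfl, rfl, ?_, ?_⟩ <;> simp

/-- A left homotopy of morphisms out of a cofibrant object gives a path in the morphisms. -/
lemma exists_path_of_leftHomotopyRel (hL : IsCofibrant L) {f g : L ⟶ X} (h : LeftHomotopyRel f g) :
    ∃ γ : L ⟶ X.path, γ ≫ X.pathEval 0 = f ∧ γ ≫ X.pathEval 1 = g := by
  obtain ⟨C, i₀, i₁, p, H, hp, h₀, h₁, rfl, rfl⟩ := (leftHomotopyRel_iff f g).1 h
  obtain ⟨γ, hγ⟩ := exists_lift_of_isCofibrant hL hp.fiberPathEnds
    (pullbackLift i₀ i₁ (h₀.trans h₁.symm))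
  refine ⟨γ ≫ pullbackFst (pathMap p) L.pathConst ≫ pathMap H, ?_, ?_⟩
  · have := congrArg (fun m => m ≫ pullbackFst p p) hγ
    simp only [Category.assoc, fiberPathEnds, pullbackLift_fst] at this
    rw [← this]
    simp only [Category.assoc, pathMap_pathEval]
  · have := congrArg (fun m => m ≫ pullbackSnd p p) hγ
    simp only [Category.assoc, fiberPathEnds, pullbackLift_snd] at this
    rw [← this]
    simp only [Category.assoc, pathMap_pathEval]

lemma leftHomotopyRel_trans (hL : IsCofibrant L) {f g h : L ⟶ X} (hfg : LeftHomotopyRel f g)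
    (hgh : LeftHomotopyRel g h) : LeftHomotopyRel f h := by
  obtain ⟨γ, hγ₀, hγ₁⟩ := exists_path_of_leftHomotopyRel hL hgh
  rw [leftHomotopyRel_iff] at hfg ⊢
  obtain ⟨C, i₀, i₁, p, H, hp, h₀, h₁, rfl, rfl⟩ := hfg
  refine ⟨pullbackAlgebroid H (X.pathEval 0),
    pullbackLift i₀ (i₀ ≫ H ≫ X.pathConst) (by simp), pullbackLift i₁ γ hγ₀.symm,
    pullbackFst H (X.pathEval 0) ≫ p, pullbackSnd H (X.pathEval 0) ≫ X.pathEval 1,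
    (LiftsDisks.pullbackFst liftsDisks_pathEval_zero).comp hp, ?_, ?_, ?_, ?_⟩
  · rw [pullbackLift_fst_assoc, h₀]
  · rw [pullbackLift_fst_assoc, h₁]
  · rw [pullbackLift_snd_assoc]; simp
  · rw [pullbackLift_snd_assoc, hγ₁]

end Homotopy

end LInfAlgebroid

end

theorem theorem4
    {E : Type*} [NormedAddCommGroup E] [NormedSpace ℝ E] [FiniteDimensional ℝ E]
    {H : Type*} [TopologicalSpace H] (I : ModelWithCorners ℝ E H)
    (M : Type u) [TopologicalSpace M] [ChartedSpace H M] [IsManifold I ∞ M] :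
    -- on morphisms out of a cofibrant object, left homotopy is an equivalence relation
    (∀ L X : LInfAlgebroid.{0, u, v} ℝ C^∞⟮I, M; ℝ⟯, IsCofibrant L →
      Equivalence (fun f g : L ⟶ X => LeftHomotopyRel f g)) ∧
    -- it is compatible with composition
    (∀ (L X Y : LInfAlgebroid.{0, u, v} ℝ C^∞⟮I, M; ℝ⟯), IsCofibrant L →
      ∀ (f f' : L ⟶ X) (g g' : X ⟶ Y), LeftHomotopyRel f f' → LeftHomotopyRel g g' →
        LeftHomotopyRel (f ≫ g) (f' ≫ g')) ∧
    -- including precomposition with a morphism out of an arbitrary object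
    (∀ (K L X : LInfAlgebroid.{0, u, v} ℝ C^∞⟮I, M; ℝ⟯), IsCofibrant L →
      ∀ (h : K ⟶ L) (f f' : L ⟶ X), LeftHomotopyRel f f' →
        LeftHomotopyRel (h ≫ f) (h ≫ f')) := by
  refine ⟨fun L X hL => ⟨LInfAlgebroid.leftHomotopyRel_refl, LInfAlgebroid.leftHomotopyRel_symm,
    LInfAlgebroid.leftHomotopyRel_trans hL⟩, fun L X Y hL f f' g g' hf hg => ?_,
    fun K L X _ h f f' hf => LInfAlgebroid.leftHomotopyRel_precomp h hf⟩
  exact LInfAlgebroid.leftHomotopyRel_trans hL (LInfAlgebroid.leftHomotopyRel_postcomp hf g)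
    (LInfAlgebroid.leftHomotopyRel_precomp f' hg)
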